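/- Let $\mathbb K$ be a field, $m\ge 2$, and for a finite simple graph $G$ let $S_G=\mathbb K[x_{ij}: i\in[m],\ j\in V(G)]$ and let $\mathcal J_{K_m,G}\subset S_G$ be the generalized binomial edge ideal, generated by all $x_{ik}x_{jl}-x_{il}x_{jk}$ with $1\le i<j\le m$ and $\{k,l\}\in E(G)$; $\dim$ denotes Krull dimension. For $p\ge 1$ let $F_p$ be the graph on $\{1,\dots,2p\}$ with edges $\{2i,2j-1\}$ for $1\le i\le j\le p$. For $p\ge 2$ its only leaves (vertices of degree one) are $1$ and $2p$. Let $K_n$ be the complete graph on $[n]$, let $k\ge 1$, and let $W=W_1\sqcup\cdots\sqcup W_k\subseteq[n]$ with nonempty sets $W_i=\{w_{i,1},\dots,w_{i,r_i}\}$. A $k$-fan graph $F_k^W(K_n)$ is obtained from $K_n$ by attaching, for all $1\le i\le k$ and $1\le j\le r_i$, a complete graph $K_{a_{i,j}}$ with $a_{i,j}>j$, which meets $K_n$ exactly in $\{w_{i,1},\dots,w_{i,j}\}$; the new vertices of different attached complete graphs are distinct and non-adjacent. For graphs $G_1,G_2$ with leaves $f_1,f_2$, whose neighbours are $v_1,v_2$,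 the graph $G_1\circ G_2$ is obtained from the disjoint union of $G_1$ and $G_2$ by removing $f_1,f_2$ and identifying $v_1$ with $v_2$ to one vertex $v$; one also writes $G_1\circ_v G_2$. Let $t\ge 2$ and $G=G_1\circ_{v_1}G_2\circ_{v_2}\cdots\circ_{v_t}G_{t+1}$, where $G_i=F_{p_i}$ with $p_i\ge 3$ for $1\le i\le t$, where $\circ_{v_i}$ glues $G_i$ and $G_{i+1}$, and where the two gluings in which $G_i$ takes part ($2\le i\le t$) use its two different leaves. Suppose that (a) $G_{t+1}=F_{p_{t+1}}$ with $p_{t+1}\ge 2$, or (b) $G_{t+1}=F_k^W(K_n)$ is a $k$-fan graph with $k\ge1$, which is glued at one of its leaves, such that either $|W|<n$, or $|W|=n$ and the neighbour $v_t$ of that leaf lies in some $W_i$ with $|W_i|\ge 2$. Then $$\dim(S_G/\mathcal J_{K_m,G})=\sum_{i=1}^{t+1}\dim(S_{G_i}/\mathcal J_{K_m,G_i})-s,$$ where $s=2m\lfloor t/2\rfloor+(m+2)\lceil t/2\rceil$ in case (a), and $s=2m\lceil t/2\rceil+(m+2)\lfloor t/2\rfloor$ in case (b). -/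

import Mathlib

/-- The binomial edge ideal of a pair of graphs `G₁`, `G₂`: the ideal of `K[x_{ak}]` generated by
the 2-minors `x_{ak} x_{bl} - x_{al} x_{bk}` with `{a, b}` an edge of `G₁` and `{k, l}` an edge
of `G₂`. (Exchanging the ends of an edge only changes the sign of the generator.) -/
noncomputable def binomialEdgeIdeal (K : Type*) [Field K] {α β : Type*}
    (G₁ : SimpleGraph α) (G₂ : SimpleGraph β) : Ideal (MvPolynomial (α × β) K) :=
  Ideal.span {q | ∃ a b k l, G₁.Adj a b ∧ G₂.Adj k l ∧
    q = MvPolynomial.X (a, k) * MvPolynomial.X (b, l)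
      - MvPolynomial.X (a, l) * MvPolynomial.X (b, k)}

/-- The Krull dimension of `S / J_{K_m, G}`, where `J_{K_m, G}` is the generalized binomial
edge ideal of `G`. -/
noncomputable def dimQuot (K : Type*) [Field K] (m : ℕ) {V : Type*} (G : SimpleGraph V) :
    WithBot ℕ∞ :=
  ringKrullDim
    (MvPolynomial (Fin m × V) K ⧸ binomialEdgeIdeal K (⊤ : SimpleGraph (Fin m)) G)

/-- The bipartite graph `F_p` on `{1, …, 2p}` with edges `{2i, 2j-1}`, `1 ≤ i ≤ j ≤ p`.
The vertex `2i` is `Sum.inl (i-1)` and the vertex `2j-1` is `Sum.inr (j-1)`. -/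
def graphF (p : ℕ) : SimpleGraph (Fin p ⊕ Fin p) where
  Adj
    | .inl i, .inr j => i ≤ j
    | .inr j, .inl i => i ≤ j
    | _, _ => False
  symm := ⟨by rintro (i | i) (j | j) h <;> exact h⟩
  loopless := ⟨by rintro (i | i) h <;> exact h⟩

/-- The data defining a `k`-fan graph of the complete graph `K_n` on the vertex set `Fin n`:
pairwise disjoint nonempty sets `W_i = {w_{i,1}, …, w_{i,r_i}}`, enumerated injectively, and
numbers `h_{i,j} ≥ 1`, the number of new vertices of the clique `K_{a_{i,j}}`,
`a_{i,j} = j + h_{i,j}`, of the branch on `W_i`. -/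
structure FanData (n k : ℕ) where
  r : Fin k → ℕ
  r_pos : ∀ i, 1 ≤ r i
  w : (i : Fin k) → Fin (r i) → Fin n
  w_injective : Function.Injective (fun x : (Σ i, Fin (r i)) => w x.1 x.2)
  h : (i : Fin k) → Fin (r i) → ℕ
  h_pos : ∀ i j, 1 ≤ h i j

namespace FanData

variable {n k : ℕ} (D : FanData n k)

/-- The set `W_i`. -/
def part (i : Fin k) : Finset (Fin n) := Finset.univ.image (D.w i)

/-- The set `W = W_1 ⊔ ⋯ ⊔ W_k`. -/
def support : Finset (Fin n) := Finset.univ.biUnion D.part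

/-- The vertices of the fan graph: those of `K_n`, and the `h_{i,j}` new vertices of each
clique `K_{a_{i,j}}`. -/
abbrev Vertex : Type := Fin n ⊕ (Σ i : Fin k, Σ j : Fin (D.r i), Fin (D.h i j))

/-- The `k`-fan graph `F_k^W(K_n)`: the clique `K_{a_{i,j}}` consists of the vertices
`w_{i,1}, …, w_{i,j}` of `K_n` and of `h_{i,j}` new vertices. -/
def graph : SimpleGraph D.Vertex where
  Adj
    | .inl x, .inl y => x ≠ y
    | .inl x, .inr ⟨i, j, _⟩ => ∃ l ≤ j, x = D.w i l
    | .inr ⟨i, j, _⟩, .inl x => ∃ l ≤ j, x = D.w i l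
    | .inr ⟨i, j, a⟩, .inr ⟨i', j', a'⟩ =>
        (⟨i, j⟩ : Σ i, Fin (D.r i)) = ⟨i', j'⟩ ∧
          (⟨i, j, a⟩ : Σ i : Fin k, Σ j : Fin (D.r i), Fin (D.h i j)) ≠ ⟨i', j', a'⟩
  symm := ⟨by
    rintro (x | ⟨i, j, a⟩) (y | ⟨i', j', a'⟩) h
    · exact Ne.symm h
    · exact h
    · exact h
    · exact ⟨h.1.symm, h.2.symm⟩⟩
  loopless := ⟨by
    rintro (x | ⟨i, j, a⟩) h
    · exact h rfl
    · exact h.2 rfl⟩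

end FanData

/-- A graph with a marked leaf, whose unique neighbour is `nbr`. -/
structure LeafGraph where
  V : Type
  graph : SimpleGraph V
  leaf : V
  nbr : V
  isLeaf : graph.neighborSet leaf = {nbr}

namespace LeafGraph

/-- The vertices of `A ∘ B`: both leaves are removed, and the neighbour of the leaf of `B` is
identified with the neighbour of the leaf of `A` (of the two, only the latter is kept). -/
abbrev CircVertex (A B : LeafGraph) : Type :=
  {x : A.V // x ≠ A.leaf} ⊕ {y : B.V // y ≠ B.leaf ∧ y ≠ B.nbr}

/-- The graph `(A, f₁) ∘ (B, f₂)`, where `f₁`, `f₂` are the marked leaves. -/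
def circGraph (A B : LeafGraph) : SimpleGraph (CircVertex A B) where
  Adj
    | .inl x, .inl x' => A.graph.Adj x x'
    | .inr y, .inr y' => B.graph.Adj y y'
    | .inl x, .inr y => x.1 = A.nbr ∧ B.graph.Adj B.nbr y
    | .inr y, .inl x => x.1 = A.nbr ∧ B.graph.Adj B.nbr y
  symm := ⟨by
    rintro (x | x) (y | y) h
    · exact SimpleGraph.Adj.symm h
    · exact h
    · exact h
    · exact SimpleGraph.Adj.symm h⟩
  loopless := ⟨by
    rintro (x | x) h
    · exact A.graph.irrefl h
    · exact B.graph.irrefl h⟩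

theorem ne_leaf_of_isLeaf (A : LeafGraph) {g w : A.V} (hg : A.graph.neighborSet g = {w})
    (h2 : g ≠ A.nbr) : w ≠ A.leaf := by
  rintro rfl
  have h : A.graph.Adj g A.leaf := by
    have : A.leaf ∈ A.graph.neighborSet g := by rw [hg]; rfl
    exact this
  have h' : g ∈ A.graph.neighborSet A.leaf := h.symm
  rw [A.isLeaf] at h'
  exact h2 h'

/-- The graph `A ∘ B`, marked with another leaf `g` of `A`. -/
def circ (A B : LeafGraph) (g w : A.V) (hg : A.graph.neighborSet g = {w})
    (h1 : g ≠ A.leaf) (h2 : g ≠ A.nbr) : LeafGraph where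
  V := CircVertex A B
  graph := circGraph A B
  leaf := .inl ⟨g, h1⟩
  nbr := .inl ⟨w, A.ne_leaf_of_isLeaf hg h2⟩
  isLeaf := by
    have key : ∀ x, A.graph.Adj g x ↔ x = w := fun x => by
      rw [← SimpleGraph.mem_neighborSet, hg, Set.mem_singleton_iff]
    ext (x | y)
    · simp only [SimpleGraph.mem_neighborSet, Set.mem_singleton_iff, Sum.inl.injEq,
        Subtype.ext_iff]
      exact key x.1
    · simp only [SimpleGraph.mem_neighborSet, Set.mem_singleton_iff, reduceCtorEq, iff_false]
      exact fun h => h2 h.1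

end LeafGraph

theorem graphF_neighborSet_last {p : ℕ} (hp : 0 < p) :
    (graphF p).neighborSet (.inl ⟨p - 1, by omega⟩) = {.inr ⟨p - 1, by omega⟩} := by
  ext (x | x)
  · simp [graphF]
  · simp only [SimpleGraph.mem_neighborSet, graphF, Set.mem_singleton_iff, Sum.inr.injEq,
      Fin.le_def, Fin.ext_iff]
    have := x.2
    omega

theorem graphF_neighborSet_first {p : ℕ} (hp : 0 < p) :
    (graphF p).neighborSet (.inr ⟨0, hp⟩) = {.inl ⟨0, hp⟩} := by
  ext (x | x)
  · simp only [SimpleGraph.mem_neighborSet, graphF, Set.mem_singleton_iff, Sum.inl.injEq,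
      Fin.le_def, Fin.ext_iff]
    omega
  · simp [graphF]

/-- `F_p`, marked with the leaf `2p`, whose neighbour is `2p-1`. -/
def leafF (p : ℕ) (hp : 0 < p) : LeafGraph where
  V := Fin p ⊕ Fin p
  graph := graphF p
  leaf := .inl ⟨p - 1, by omega⟩
  nbr := .inr ⟨p - 1, by omega⟩
  isLeaf := graphF_neighborSet_last hp

/-- `F_p ∘ B`, glued at the leaf `2p` of `F_p` and the marked leaf of `B`; the result is marked
with the other leaf `1` of `F_p`, whose neighbour is `2`. -/
def prependF (p : ℕ) (hp : 3 ≤ p) (B : LeafGraph) : LeafGraph :=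
  (leafF p (by omega)).circ B (.inr ⟨0, by omega⟩) (.inl ⟨0, by omega⟩)
    (graphF_neighborSet_first (by omega))
    (by simp [leafF])
    (by simp only [leafF, ne_eq, Sum.inr.injEq, Fin.mk.injEq]; omega)

/-- The iterated gluing `F_{p_1} ∘ (F_{p_2} ∘ ⋯ ∘ (F_{p_t} ∘ B))`, with consecutive graphs glued
at the two different leaves of each `F_{p_i}` and at the marked leaf of `B`. Which of the two
leaves of `F_{p_i}` comes first does not matter, since an automorphism of `F_{p_i}` exchanges
them. -/
def chainF : (t : ℕ) → (p : Fin t → ℕ) → (∀ i, 3 ≤ p i) → LeafGraph → LeafGraph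
  | 0, _, _, B => B
  | t + 1, p, hp, B => prependF (p 0) (hp 0) (chainF t (fun i => p i.succ) (fun i => hp i.succ) B)

/-!
A prime `P` of the polynomial ring contains `J_{K_m, G}` if and only if, modulo `P`, the columns
of variables `(x_{1v}, …, x_{mv})` at adjacent vertices are proportional. Removing the vertices
whose column vanishes and grouping the others by proportionality gives what is called a labelling
of `G` below: a set of removed vertices, and a partition of the other vertices whose classes are
unions of connected components. If there are `ℓ` classes, then the quotient by `P` has transcendence
degree at most `(m - 1) ℓ + #{remaining vertices}` (`exists_isLabelling_ringKrullDim_le`), and every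
labelling is realized by a prime for which this bound is attained (`IsLabelling.le_dimQuot`). For
finitely generated domains over a field, dimension and transcendence degree agree. Hence
`dim (S / J_{K_m, G}) = |V(G)| + max ((m - 1) #classes - #removed)` (`IsMaxWeight.dimQuot_eq`),
and the theorem becomes a statement about maximal weights `(b + 1) #classes - #removed` of
labellings, where `b = m - 2`.

A labelling of `A ∘ B` is a pair of labellings of `A` and `B` without their leaves which agree on
whether the identified vertex `v` is removed; its weight is the sum of the two weights, plus `1` if
`v` is removed twice, and minus `b + 1` if `v` is kept, since two classes are then merged
(`LeafGraph.weight_glue`). So a graph with a marked leaf enters only through two numbers, the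
maximal weights of the graph without its leaf when the neighbour of the leaf is kept or removed.
For `F_p` the number of classes is at most `p`, by the perfect matching `{2i, 2i-1}`, and at most
one more than the number of removed vertices; so the maximal weight is `b p + 1`, and putting the
leaves back gives the maxima of `F_p` without one or both of its leaves.

Two situations occur. A marked graph has *kept type* if the maximum with the neighbour kept exceeds
the other one by exactly `b + 1`, and *cut type* if it exceeds it by at most `1`. Prepending an
`F_p` turns kept type into cut type and conversely, and the two steps lose different multiples of
`b` (`LeafGraph.IsKeptType.prependF`, `LeafGraph.IsCutType.prependF`): this alternation produces the
floor and the ceiling of `t / 2`. Finally, `F_q` has kept type (`isKeptType_graphF`), while a fan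
graph has cut type: by the hypothesis on `W`, the neighbour `v` of its leaf dominates another vertex
`u` (`FanData.exists_dominated`), so that in any labelling `u` may take over the role of `v`
(`LeafGraph.isCutType_of_dominated`).
-/

/-! ### Krull dimension of finitely generated algebras -/

theorem ringKrullDim_eq_of_injective_of_isIntegral {R S : Type*} [CommRing R] [CommRing S]
    [IsDomain S] [Algebra R S] [Algebra.IsIntegral R S]
    (h : Function.Injective (algebraMap R S)) : ringKrullDim S = ringKrullDim R := by
  apply le_antisymm
  · refine Order.krullDim_le_of_strictMono (PrimeSpectrum.comap (algebraMap R S)) ?_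
    intro P Q hPQ
    exact Ideal.IsIntegral.comap_lt_comap (R := R) (I := P.asIdeal) (J := Q.asIdeal) hPQ
  · refine iSup_le fun l ↦ ?_
    obtain ⟨Q, hQ, hQ'⟩ := Ideal.exists_ideal_over_prime_of_isIntegral_of_isDomain
      (S := S) l.head.asIdeal (by
        rw [(RingHom.injective_iff_ker_eq_bot _).1 h]; exact bot_le)
    have : Q.LiesOver l.head.asIdeal := ⟨hQ'.symm⟩
    obtain ⟨L, hL, -⟩ := Ideal.exists_ltSeries_of_hasGoingUp l Q
    exact hL ▸ Order.LTSeries.length_le_krullDim L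

/-- By Noether normalization, the Krull dimension of a finitely generated domain over a field is
its transcendence degree. -/
theorem exists_ringKrullDim_eq_and_trdeg_eq (K A : Type*) [Field K] [CommRing A] [IsDomain A]
    [Algebra K A] [Algebra.FiniteType K A] :
    ∃ s : ℕ, ringKrullDim A = s ∧ Algebra.trdeg K A = s := by
  obtain ⟨s, g, hg, hgi⟩ := exists_integral_inj_algHom_of_fg K A
  let _ := g.toRingHom.toAlgebra
  have : IsScalarTower K (MvPolynomial (Fin s) K) A :=
    IsScalarTower.of_algebraMap_eq fun x ↦ (g.commutes x).symm
  have : Algebra.IsIntegral (MvPolynomial (Fin s) K) A := ⟨hgi⟩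
  have hinj : Function.Injective (algebraMap (MvPolynomial (Fin s) K) A) := hg
  have : FaithfulSMul (MvPolynomial (Fin s) K) A :=
    (faithfulSMul_iff_algebraMap_injective _ _).2 hinj
  refine ⟨s, ?_, ?_⟩
  · rw [ringKrullDim_eq_of_injective_of_isIntegral hinj]
    simp
  · have := ((IsTranscendenceBasis.mvPolynomial (Fin s) K).algebraMap_comp
      (A := A)).lift_cardinalMk_eq_trdeg
    simpa using this.symm

/-- A finitely generated domain over a field that is algebraic over the subalgebra generated by a
finite family has dimension at most the size of the family. -/
theorem ringKrullDim_le_natCard_of_isAlgebraic_adjoin {K A ι : Type*} [Field K] [CommRing A]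
    [IsDomain A] [Algebra K A] [Algebra.FiniteType K A] [Finite ι] (f : ι → A)
    (h : Algebra.IsAlgebraic (Algebra.adjoin K (Set.range f)) A) :
    ringKrullDim A ≤ Nat.card ι := by
  obtain ⟨s, hs, hs'⟩ := exists_ringKrullDim_eq_and_trdeg_eq K A
  have h1 := Algebra.IsAlgebraic.trdeg_le_cardinalMk K (Set.range f)
  have h2 : (s : ℕ) ≤ Nat.card (Set.range f) := by
    rw [hs', ← Nat.cast_card] at h1
    exact_mod_cast h1
  rw [hs]
  exact_mod_cast h2.trans (Finite.card_range_le f)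

/-- If a polynomial ring in the variables `ι` is algebraic over the image of an algebra map from
`S`, then the quotient of `S` by any ideal mapped to zero has dimension at least the number of
variables. -/
theorem natCard_le_ringKrullDim_quotient {K S ι : Type*} [Field K] [CommRing S] [Algebra K S]
    [Algebra.FiniteType K S] [Finite ι] (f : S →ₐ[K] MvPolynomial ι K) (I : Ideal S)
    (hI : ∀ x ∈ I, f x = 0)
    (h : ∀ i, IsAlgebraic f.range (MvPolynomial.X i : MvPolynomial ι K)) :
    (Nat.card ι : WithBot ℕ∞) ≤ ringKrullDim (S ⧸ I) := by
  have hfg : Algebra.FiniteType K f.range :=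
    Algebra.FiniteType.of_surjective f.rangeRestrict f.rangeRestrict_surjective
  obtain ⟨s, hs, hs'⟩ := exists_ringKrullDim_eq_and_trdeg_eq K f.range
  have halg : Algebra.IsAlgebraic f.range (MvPolynomial ι K) :=
    (IsTranscendenceBasis.mvPolynomial ι K).isAlgebraic_iff.2 h
  have h1 := lift_trdeg_add_eq K f.range (MvPolynomial ι K)
  rw [trdeg_eq_zero (R := f.range), hs', MvPolynomial.trdeg_of_isDomain] at h1
  have h2 : s = Nat.card ι := by
    have := congrArg Cardinal.toNat h1
    simpa [Nat.card] using this
  rw [← h2, ← hs]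
  refine ringKrullDim_le_of_surjective
    (Ideal.Quotient.lift I f.rangeRestrict.toRingHom fun x hx ↦ Subtype.ext (hI x hx)) ?_
  exact Ideal.Quotient.lift_surjective_of_surjective _ _ f.rangeRestrict_surjective

/-- The dimension of a quotient is bounded by the dimensions of its quotients by primes. -/
theorem ringKrullDim_quotient_le_of_forall_prime {S : Type*} [CommRing S] (I : Ideal S)
    (d : WithBot ℕ∞) (h : ∀ P : Ideal S, P.IsPrime → I ≤ P → ringKrullDim (S ⧸ P) ≤ d) :
    ringKrullDim (S ⧸ I) ≤ d := by
  rw [ringKrullDim_quotient]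
  refine iSup_le fun l ↦ ?_
  refine le_trans ?_ (h l.head.1.asIdeal l.head.1.isPrime l.head.2)
  rw [ringKrullDim_quotient]
  -- A chain of primes over `I` is a chain of primes over its smallest member.
  let l' : LTSeries (PrimeSpectrum.zeroLocus (l.head.1.asIdeal : Set S)) :=
    LTSeries.mk l.length (fun i ↦ ⟨(l i).1, l.head_le i⟩) fun i j hij ↦ l.strictMono hij
  exact Order.LTSeries.length_le_krullDim l'

/-! ### Labellings and the dimension of the generalized binomial edge ideal -/

/-- A labelling of `G` records a set of removed vertices, those with value `none`, and a partition
of the others into classes, given by the labels, such that adjacent vertices lie in the same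
class. Every class is thus a union of connected components of what remains of `G`. -/
def IsLabelling {V L : Type*} (G : SimpleGraph V) (φ : V → Option L) : Prop :=
  ∀ ⦃u v⦄, G.Adj u v → ∀ ⦃k l⦄, φ u = some k → φ v = some l → k = l

/-- The set of labels that occur. -/
def labels {V L : Type*} (φ : V → Option L) : Set L := {l | ∃ v, φ v = some l}

/-- The set of removed vertices. -/
def cut {V L : Type*} (φ : V → Option L) : Set V := {v | φ v = none}

/-- The number of labels times `B + 1`, minus the number of removed vertices. For `B = m - 2` the
maximal weight of a labelling of `G` is `dim (S / J_{K_m, G}) - |V(G)|`. -/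
noncomputable def weight {V L : Type*} (B : ℤ) (φ : V → Option L) : ℤ :=
  (B + 1) * (labels φ).ncard - (cut φ).ncard

/-- `w` is the maximal weight of a labelling of `G`. -/
def IsMaxWeight {V : Type*} (B : ℤ) (G : SimpleGraph V) (w : ℤ) : Prop :=
  IsGreatest {x | ∃ φ : V → Option ℕ, IsLabelling G φ ∧ weight B φ = x} w

theorem labels_finite {V L : Type*} [Finite V] (φ : V → Option L) : (labels φ).Finite :=
  ((Set.finite_range φ).preimage (Option.some_injective L).injOn).subset
    fun _ ⟨v, hv⟩ ↦ ⟨v, hv⟩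

theorem IsLabelling.map {V L L' : Type*} {G : SimpleGraph V} {φ : V → Option L}
    (h : IsLabelling G φ) (f : L → L') : IsLabelling G fun v ↦ (φ v).map f := by
  intro u v huv k l hu hv
  obtain ⟨k', hk', rfl⟩ := Option.map_eq_some_iff.1 hu
  obtain ⟨l', hl', rfl⟩ := Option.map_eq_some_iff.1 hv
  rw [h huv hk' hl']

theorem labels_map {V L L' : Type*} (φ : V → Option L) (f : L → L') :
    labels (fun v ↦ (φ v).map f) = f '' labels φ := by
  ext l
  constructor
  · rintro ⟨v, hv⟩
    obtain ⟨k, hk, rfl⟩ := Option.map_eq_some_iff.1 hv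
    exact ⟨k, ⟨v, hk⟩, rfl⟩
  · rintro ⟨k, ⟨v, hv⟩, rfl⟩
    exact ⟨v, by simp [hv]⟩

theorem weight_map {V L L' : Type*} (B : ℤ) (φ : V → Option L) {f : L → L'}
    (hf : Set.InjOn f (labels φ)) : weight B (fun v ↦ (φ v).map f) = weight B φ := by
  rw [weight, weight, labels_map, hf.ncard_image]
  simp [cut]

/-- Labels may be taken in any type. -/
theorem IsLabelling.exists_nat {V L : Type*} [Finite V] {G : SimpleGraph V} {φ : V → Option L}
    (h : IsLabelling G φ) (B : ℤ) :
    ∃ ψ : V → Option ℕ, IsLabelling G ψ ∧ weight B ψ = weight B φ := by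
  obtain ⟨f, hf⟩ := Set.countable_iff_exists_injOn.1 (labels_finite φ).countable
  exact ⟨_, h.map f, weight_map B φ hf⟩

section

universe u

variable {K : Type*} [Field K] {V : Type u} [Finite V] {G : SimpleGraph V}

open MvPolynomial

/-- The map `x_{iv} ↦ s_v y_{φ(v), i}`, where `y_{l, 0} = 1`, has image of dimension
`(m - 1) * #labels + #{v | φ v ≠ none}`. -/
theorem IsLabelling.le_dimQuot {m : ℕ} (hm : 1 ≤ m) {L : Type*} {φ : V → Option L}
    (h : IsLabelling G φ) :
    (((m - 1) * (labels φ).ncard + Nat.card {v // φ v ≠ none} : ℕ) : WithBot ℕ∞) ≤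
      dimQuot K m G := by
  classical
  let i₀ : Fin m := ⟨0, hm⟩
  have : Finite (labels φ) := labels_finite φ
  let ι := (labels φ × {i : Fin m // i ≠ i₀}) ⊕ {v // φ v ≠ none}
  let s : V → MvPolynomial ι K := fun v ↦ if hv : φ v ≠ none then X (.inr ⟨v, hv⟩) else 0
  let y : Option L → Fin m → MvPolynomial ι K := fun o i ↦
    o.elim 0 fun l ↦ if hi : i ≠ i₀ then
      if hl : l ∈ labels φ then X (.inl (⟨l, hl⟩, ⟨i, hi⟩)) else 0 else 1
  let f : MvPolynomial (Fin m × V) K →ₐ[K] MvPolynomial ι K := aeval fun x ↦ s x.2 * y (φ x.2) x.1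
  have hf : ∀ i v, f (X (i, v)) = s v * y (φ v) i := fun i v ↦ by simp [f]
  have hmem : ∀ v (hv : φ v ≠ none), X (.inr ⟨v, hv⟩) ∈ f.range := by
    intro v hv
    obtain ⟨l, hl⟩ := Option.ne_none_iff_exists'.1 hv
    exact ⟨X (i₀, v), by simp [hf, s, y, hl]⟩
  have key := natCard_le_ringKrullDim_quotient f
    (binomialEdgeIdeal K (⊤ : SimpleGraph (Fin m)) G) ?_ ?_
  · have hc : Nat.card ι = (m - 1) * (labels φ).ncard + Nat.card {v // φ v ≠ none} := by
      simp only [ι, Nat.card_sum, Nat.card_prod]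
      congr 1
      rw [mul_comm, Nat.card_coe_set_eq]
      simp
    rw [hc] at key
    exact key
  · suffices binomialEdgeIdeal K (⊤ : SimpleGraph (Fin m)) G ≤ RingHom.ker f from
      fun x hx ↦ this hx
    refine Ideal.span_le.2 ?_
    rintro _ ⟨a, b, k, l, -, hkl, rfl⟩
    simp only [SetLike.mem_coe, RingHom.mem_ker, map_sub, map_mul, hf]
    rcases hk : φ k with _ | c
    · simp [y]
    rcases hl : φ l with _ | d
    · simp [y]
    rw [h hkl hk hl]
    ring
  · rintro (⟨⟨l, hl⟩, i, hi⟩ | ⟨v, hv⟩)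
    · obtain ⟨v, hv⟩ := id hl
      have hv' : φ v ≠ none := by simp [hv]
      have h1 : X (.inr ⟨v, hv'⟩) * X (.inl (⟨l, hl⟩, ⟨i, hi⟩)) ∈ f.range :=
        ⟨X (i, v), by simp [hf, s, y, hv, hi, hl]⟩
      exact IsAlgebraic.of_mul (mem_nonZeroDivisors_of_ne_zero (X_ne_zero _))
        (isAlgebraic_algebraMap (⟨_, hmem v hv'⟩ : f.range))
        (isAlgebraic_algebraMap (⟨_, h1⟩ : f.range))
    · exact isAlgebraic_algebraMap (⟨_, hmem v hv⟩ : f.range)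

/-- For a prime `P` over the ideal, call two columns of variables equivalent if they are nonzero
and proportional modulo `P`. The columns that vanish modulo `P` and the classes of the others form
a labelling. Modulo `P`, all entries of a column are algebraic over one of its entries and the
entries of a fixed column in its class. -/
theorem exists_isLabelling_ringKrullDim_le {m : ℕ} (hm : 1 ≤ m)
    (P : Ideal (MvPolynomial (Fin m × V) K)) [P.IsPrime]
    (hP : binomialEdgeIdeal K (⊤ : SimpleGraph (Fin m)) G ≤ P) :
    ∃ (L : Type u) (φ : V → Option L), Finite L ∧ IsLabelling G φ ∧ (∀ l, ∃ v, φ v = some l) ∧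
      ringKrullDim (MvPolynomial (Fin m × V) K ⧸ P) ≤
        (((m - 1) * Nat.card L + Nat.card {v // φ v ≠ none} : ℕ) : WithBot ℕ∞) := by
  classical
  let A := MvPolynomial (Fin m × V) K ⧸ P
  let x : Fin m → V → A := fun i v ↦ Ideal.Quotient.mk P (X (i, v))
  let W := {v : V // ∃ i, x i v ≠ 0}
  let S : Setoid W :=
    { r := fun v w ↦ ∀ i j, x i v * x j w = x j v * x i w
      iseqv := by
        refine ⟨fun v i j ↦ mul_comm _ _, fun {v w} h i j ↦ ?_, fun {u v w} h h' i j ↦ ?_⟩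
        · linear_combination h j i
        · obtain ⟨k, hk⟩ := v.2
          refine mul_left_cancel₀ hk ?_
          linear_combination x j w * h i k + x k u * h' i j - x i w * h j k }
  let φ : V → Option (Quotient S) := fun v ↦
    if hv : ∃ i, x i v ≠ 0 then some (Quotient.mk S ⟨v, hv⟩) else none
  have hφ : ∀ v, φ v ≠ none ↔ ∃ i, x i v ≠ 0 := fun v ↦ by
    by_cases hv : ∃ i, x i v ≠ 0
    · simp only [φ, dif_pos hv, ne_eq, reduceCtorEq, not_false_eq_true, hv]
    · simp only [φ, dif_neg hv, ne_eq, not_true_eq_false, hv]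
  refine ⟨Quotient S, φ, inferInstance, ?_, ?_, ?_⟩
  · intro u v huv k l hu hv
    have hu' := (hφ u).1 (by simp [hu])
    have hv' := (hφ v).1 (by simp [hv])
    simp only [φ, dif_pos hu', Option.some.injEq] at hu
    simp only [φ, dif_pos hv', Option.some.injEq] at hv
    rw [← hu, ← hv]
    refine Quotient.sound fun i j ↦ ?_
    rcases eq_or_ne i j with rfl | hij
    · rfl
    have := hP (Ideal.subset_span ⟨i, j, u, v, by simpa using hij, huv, rfl⟩)
    rw [← Ideal.Quotient.eq_zero_iff_mem, map_sub, map_mul, map_mul, sub_eq_zero] at this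
    rw [mul_comm (x j u)]
    exact this
  · intro l
    obtain ⟨⟨v, hv⟩, rfl⟩ := Quotient.exists_rep l
    exact ⟨v, by simp only [φ, dif_pos hv]⟩
  · let i₀ : Fin m := ⟨0, hm⟩
    have hp (l : Quotient S) : ∃ i, x i l.out.1 ≠ 0 := l.out.2
    choose p hp using hp
    let ι := (Quotient S × {i : Fin m // i ≠ i₀}) ⊕ {v // φ v ≠ none}
    let f : ι → A := Sum.elim (fun a ↦ x (Equiv.swap i₀ (p a.1) a.2) a.1.out.1)
      (fun v ↦ x (p (Quotient.mk S ⟨v.1, (hφ v.1).1 v.2⟩)) v.1)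
    have hs : ∀ v (hv : φ v ≠ none), IsAlgebraic (Algebra.adjoin K (Set.range f))
        (x (p (Quotient.mk S ⟨v, (hφ v).1 hv⟩)) v) := fun v hv ↦
      isAlgebraic_algebraMap
        (⟨_, Algebra.subset_adjoin ⟨.inr ⟨v, hv⟩, rfl⟩⟩ : Algebra.adjoin K (Set.range f))
    have hl : ∀ (l : Quotient S) i, IsAlgebraic (Algebra.adjoin K (Set.range f))
        (x i l.out.1) := by
      intro l i
      by_cases hi : i = p l
      · have := hs l.out.1 ((hφ _).2 l.out.2)
        simpa [hi] using this
      · -- The transposition identifies the indices other than `p l` with those other than `i₀`.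
        refine isAlgebraic_algebraMap (⟨_, Algebra.subset_adjoin
          ⟨.inl ⟨l, Equiv.swap i₀ (p l) i, ?_⟩, ?_⟩⟩ : Algebra.adjoin K (Set.range f))
        · rwa [ne_eq, Equiv.swap_apply_eq_iff, Equiv.swap_apply_left]
        · exact congrArg (fun j ↦ x j l.out.1) (by simp)
    have hx : ∀ i v, IsAlgebraic (Algebra.adjoin K (Set.range f)) (x i v) := by
      intro i v
      by_cases hv : φ v = none
      · have : x i v = 0 := by
          by_contra h
          exact (hφ v).2 ⟨i, h⟩ hv
        rw [this]
        exact isAlgebraic_zero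
      · have hv' := (hφ v).1 hv
        have hrel : ∀ i j, x i (Quotient.mk S ⟨v, hv'⟩).out.1 * x j v = _ :=
          Quotient.mk_out (s := S) ⟨v, hv'⟩
        refine IsAlgebraic.of_mul (mem_nonZeroDivisors_of_ne_zero
          (hp (Quotient.mk S ⟨v, hv'⟩))) (hl _ _) ?_
        rw [hrel]
        exact (hl _ _).mul (hs v hv)
    have halg : Algebra.IsAlgebraic (Algebra.adjoin K (Set.range f)) A := by
      refine ⟨fun a ↦ ?_⟩
      obtain ⟨q, rfl⟩ := Ideal.Quotient.mk_surjective a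
      induction q using MvPolynomial.induction_on with
      | C c => exact isAlgebraic_algebraMap (algebraMap K (Algebra.adjoin K (Set.range f)) c)
      | add q r hq hr => rw [map_add]; exact hq.add hr
      | mul_X q n hq => rw [map_mul]; exact hq.mul (hx n.1 n.2)
    have := ringKrullDim_le_natCard_of_isAlgebraic_adjoin f halg
    have hc : Nat.card ι = (m - 1) * Nat.card (Quotient S) + Nat.card {v // φ v ≠ none} := by
      simp only [ι, Nat.card_sum, Nat.card_prod]
      congr 1
      rw [mul_comm]
      simp
    rw [hc] at this
    exact this

theorem weight_add_card {m : ℕ} (hm : 1 ≤ m) {L : Type*}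
    (φ : V → Option L) :
    weight (m - 2 : ℤ) φ + Nat.card V =
      ((m - 1) * (labels φ).ncard + Nat.card {v // φ v ≠ none} : ℕ) := by
  have h := Set.ncard_add_ncard_compl (cut φ)
  have h' : (cut φ)ᶜ.ncard = Nat.card {v // φ v ≠ none} := rfl
  rw [← h', ← h, weight]
  push_cast [Nat.cast_sub hm]
  ring

/-- The dimension of `S / J_{K_m, G}` is the number of vertices plus the maximal weight. -/
theorem IsMaxWeight.dimQuot_eq {m : ℕ} (hm : 1 ≤ m) {w : ℤ} (hw : IsMaxWeight (m - 2) G w) :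
    ∃ d : ℕ, dimQuot K m G = d ∧ (d : ℤ) = w + Nat.card V := by
  obtain ⟨⟨φ, hφ, rfl⟩, hmax⟩ := hw
  refine ⟨_, ?_, (weight_add_card hm φ).symm⟩
  apply le_antisymm
  · refine ringKrullDim_quotient_le_of_forall_prime _ _ fun P _ hP ↦ ?_
    obtain ⟨L, ψ, _, hψ, hsurj, hle⟩ := exists_isLabelling_ringKrullDim_le hm P hP
    refine hle.trans ?_
    obtain ⟨χ, hχ, hχw⟩ := hψ.exists_nat (m - 2)
    have h1 := weight_add_card hm ψ
    have h2 := weight_add_card hm φ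
    have h3 := hmax ⟨χ, hχ, rfl⟩
    have h4 : labels ψ = Set.univ := Set.eq_univ_of_forall hsurj
    rw [h4, Set.ncard_univ] at h1
    have h5 : weight (m - 2 : ℤ) χ ≤ weight (m - 2 : ℤ) φ := h3
    rw [hχw] at h5
    rw [Nat.cast_le]
    exact Int.ofNat_le.1 (by linarith)
  · exact hφ.le_dimQuot hm

end

theorem weight_comp_equiv {V V' L : Type*} (B : ℤ) (e : V ≃ V') (φ : V' → Option L) :
    weight B (φ ∘ e) = weight B φ := by
  have h1 : labels (φ ∘ e) = labels φ :=
    Set.ext fun l ↦ (e.surjective.exists (p := fun v ↦ φ v = some l)).symm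
  have h2 : (cut (φ ∘ e)).ncard = (cut φ).ncard :=
    Set.ncard_preimage_of_injective_subset_range (s := cut φ) e.injective
      (by simp [e.surjective.range_eq])
  rw [weight, weight, h1, h2]

theorem IsLabelling.comp_hom {V V' L : Type*} {G : SimpleGraph V} {G' : SimpleGraph V'}
    {φ : V' → Option L} (h : IsLabelling G' φ) (e : G →g G') : IsLabelling G (φ ∘ e) :=
  fun _ _ huv _ _ hk hl ↦ h (e.map_adj huv) hk hl

theorem IsMaxWeight.of_iso {V V' : Type*} {B w : ℤ} {G : SimpleGraph V} {G' : SimpleGraph V'}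
    (e : G ≃g G') (h : IsMaxWeight B G' w) : IsMaxWeight B G w := by
  obtain ⟨⟨φ, hφ, rfl⟩, hmax⟩ := h
  refine ⟨⟨φ ∘ e, hφ.comp_hom e.toHom, weight_comp_equiv B e.toEquiv φ⟩, ?_⟩
  rintro _ ⟨ψ, hψ, rfl⟩
  exact hmax ⟨ψ ∘ e.symm, hψ.comp_hom e.symm.toHom, weight_comp_equiv B e.symm.toEquiv ψ⟩

/-! ### Labellings of glued graphs -/

theorem IsLabelling.update_some {V L : Type*} [DecidableEq V] {G : SimpleGraph V}
    {φ : V → Option L} (h : IsLabelling G φ) {f : V} {l : L}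
    (hl : ∀ x, G.Adj f x → ∀ k, φ x = some k → k = l) :
    IsLabelling G (Function.update φ f (some l)) := by
  intro u v huv k k' hk hk'
  rcases eq_or_ne u f with rfl | hu <;> rcases eq_or_ne v u with rfl | hv
  · exact (G.irrefl huv).elim
  · rw [Function.update_self, Option.some_inj] at hk
    rw [Function.update_of_ne hv] at hk'
    rw [← hk, hl v huv k' hk']
  · exact (G.irrefl huv).elim
  · rw [Function.update_of_ne hu] at hk
    rcases eq_or_ne v f with rfl | hv'
    · rw [Function.update_self, Option.some_inj] at hk'
      rw [← hk', hl u huv.symm k hk]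
    · rw [Function.update_of_ne hv'] at hk'
      exact h huv hk hk'

theorem IsLabelling.update_none {V L : Type*} [DecidableEq V] {G : SimpleGraph V}
    {φ : V → Option L} (h : IsLabelling G φ) (f : V) :
    IsLabelling G (Function.update φ f none) := by
  have key : ∀ {u k}, Function.update φ f none u = some k → φ u = some k := by
    intro u k hk
    rcases eq_or_ne u f with rfl | hu
    · simp at hk
    · rwa [Function.update_of_ne hu] at hk
  exact fun u v huv k k' hk hk' ↦ h huv (key hk) (key hk')

theorem cut_ncard_update_some {V L : Type*} [Finite V] [DecidableEq V] {φ : V → Option L} {f : V}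
    (hf : φ f = none) (l : L) :
    (cut (Function.update φ f (some l))).ncard + 1 = (cut φ).ncard := by
  have h : cut (Function.update φ f (some l)) = cut φ \ {f} := by
    ext v
    rcases eq_or_ne v f with rfl | hv
    · simp [cut]
    · simp [cut, hv]
  rw [h, Set.ncard_sdiff_singleton_add_one (s := cut φ) hf]

theorem labels_update_some {V L : Type*} [DecidableEq V] {φ : V → Option L} {f : V}
    (hf : φ f = none) (l : L) :
    labels (Function.update φ f (some l)) = insert l (labels φ) := by
  ext k
  constructor
  · rintro ⟨v, hv⟩
    rcases eq_or_ne v f with rfl | hvf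
    · rw [Function.update_self, Option.some_inj] at hv
      exact .inl hv.symm
    · rw [Function.update_of_ne hvf] at hv
      exact .inr ⟨v, hv⟩
  · rintro (rfl | ⟨v, hv⟩)
    · exact ⟨f, by simp⟩
    · have hvf : v ≠ f := by
        rintro rfl
        simp [hf] at hv
      exact ⟨v, by rwa [Function.update_of_ne hvf]⟩

theorem weight_update_some_of_mem {V L : Type*} [Finite V] [DecidableEq V] {φ : V → Option L}
    {f : V} (B : ℤ) (hf : φ f = none) {l : L} (hl : l ∈ labels φ) :
    weight B (Function.update φ f (some l)) = weight B φ + 1 := by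
  rw [weight, weight, labels_update_some hf, Set.insert_eq_of_mem hl,
    ← cut_ncard_update_some hf l]
  push_cast
  ring

theorem weight_update_some_of_notMem {V L : Type*} [Finite V] [DecidableEq V] {φ : V → Option L}
    {f : V} (B : ℤ) (hf : φ f = none) {l : L} (hl : l ∉ labels φ) :
    weight B (Function.update φ f (some l)) = weight B φ + (B + 2) := by
  rw [weight, weight, labels_update_some hf, Set.ncard_insert_of_notMem hl (labels_finite φ),
    ← cut_ncard_update_some hf l]
  push_cast
  ring

section Leaf

variable {V : Type*} [Finite V] {G : SimpleGraph V} {f v : V} {φ : V → Option ℕ}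

/-- A removed leaf whose neighbour is present can be put back into the class of its neighbour. -/
theorem IsLabelling.exists_weight_add_one (h : IsLabelling G φ) (hv : G.neighborSet f = {v})
    (hf : φ f = none) (hφ : φ v ≠ none) (B : ℤ) :
    ∃ ψ : V → Option ℕ, IsLabelling G ψ ∧ weight B ψ = weight B φ + 1 ∧
      ∀ x ≠ f, ψ x = φ x := by
  classical
  obtain ⟨l, hl⟩ := Option.ne_none_iff_exists'.1 hφ
  refine ⟨_, h.update_some (f := f) (l := l) ?_, weight_update_some_of_mem B hf ⟨v, hl⟩,
    fun x hx ↦ Function.update_of_ne hx _ _⟩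
  intro x hx k hk
  obtain rfl : x = v := by
    have : x ∈ G.neighborSet f := hx
    rwa [hv] at this
  rwa [hl, Option.some_inj, eq_comm] at hk

/-- A removed leaf whose neighbour is removed can be put back as a class of its own. -/
theorem IsLabelling.exists_weight_add (h : IsLabelling G φ) (hv : G.neighborSet f = {v})
    (hf : φ f = none) (hφ : φ v = none) (B : ℤ) :
    ∃ ψ : V → Option ℕ, IsLabelling G ψ ∧ weight B ψ = weight B φ + (B + 2) ∧
      ∀ x ≠ f, ψ x = φ x := by
  classical
  obtain ⟨l, hl⟩ := (labels_finite φ).exists_notMem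
  refine ⟨_, h.update_some (f := f) (l := l) ?_, weight_update_some_of_notMem B hf hl,
    fun x hx ↦ Function.update_of_ne hx _ _⟩
  intro x hx k hk
  obtain rfl : x = v := by
    have : x ∈ G.neighborSet f := hx
    rwa [hv] at this
  simp [hφ] at hk

end Leaf

namespace LeafGraph

variable {A B : LeafGraph}

theorem adj_leaf_iff (A : LeafGraph) {x : A.V} : A.graph.Adj A.leaf x ↔ x = A.nbr := by
  rw [← SimpleGraph.mem_neighborSet, A.isLeaf, Set.mem_singleton_iff]

theorem nbr_ne_leaf (A : LeafGraph) : A.nbr ≠ A.leaf :=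
  (A.adj_leaf_iff.2 rfl).ne'

/-- The labelling of `A ∘ B` given by labellings of `A` and `B` that agree at the neighbours of
the leaves. -/
def glue {L : Type*} (φ : A.V → Option L) (ψ : B.V → Option L) : CircVertex A B → Option L :=
  Sum.elim (fun x ↦ φ x.1) (fun y ↦ ψ y.1)

section

variable {L : Type*} {φ : A.V → Option L} {ψ : B.V → Option L}

theorem labels_glue (hφ : φ A.leaf = none) (hψ : ψ B.leaf = none) (h : φ A.nbr = ψ B.nbr) :
    labels (glue φ ψ) = labels φ ∪ labels ψ := by
  ext l
  constructor
  · rintro ⟨x | y, hx⟩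
    · exact .inl ⟨x.1, hx⟩
    · exact .inr ⟨y.1, hx⟩
  · rintro (⟨x, hx⟩ | ⟨y, hy⟩)
    · refine ⟨.inl ⟨x, ?_⟩, hx⟩
      rintro rfl
      simp [hφ] at hx
    · have hyl : y ≠ B.leaf := by
        rintro rfl
        simp [hψ] at hy
      rcases eq_or_ne y B.nbr with rfl | hyn
      · exact ⟨.inl ⟨A.nbr, A.nbr_ne_leaf⟩, h.trans hy⟩
      · exact ⟨.inr ⟨y, hyl, hyn⟩, hy⟩

theorem isLabelling_glue (hφ : IsLabelling A.graph φ) (hψ : IsLabelling B.graph ψ)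
    (h : φ A.nbr = ψ B.nbr) : IsLabelling (circGraph A B) (glue φ ψ) := by
  rintro (x | x) (y | y) hxy k l hk hl
  · exact hφ hxy hk hl
  · refine hψ hxy.2 ?_ hl
    rw [← h, ← hxy.1]
    exact hk
  · refine hψ hxy.2.symm hk ?_
    rw [← h, ← hxy.1]
    exact hl
  · exact hψ hxy hk hl

/-- Every labelling of `A ∘ B` is glued from labellings of `A` and `B`. -/
theorem exists_eq_glue {χ : CircVertex A B → Option L} (hχ : IsLabelling (circGraph A B) χ) :
    ∃ (φ : A.V → Option L) (ψ : B.V → Option L), IsLabelling A.graph φ ∧ IsLabelling B.graph ψ ∧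
      φ A.leaf = none ∧ ψ B.leaf = none ∧ φ A.nbr = ψ B.nbr ∧ χ = glue φ ψ := by
  classical
  let φ : A.V → Option L := fun x ↦ if hx : x = A.leaf then none else χ (.inl ⟨x, hx⟩)
  let ψ : B.V → Option L := fun y ↦ if hy : y = B.leaf then none else
    if hy' : y = B.nbr then χ (.inl ⟨A.nbr, A.nbr_ne_leaf⟩) else χ (.inr ⟨y, hy, hy'⟩)
  have hψn : ψ B.nbr = χ (.inl ⟨A.nbr, A.nbr_ne_leaf⟩) := by
    simp only [ψ, dif_neg B.nbr_ne_leaf, dif_pos]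
  refine ⟨φ, ψ, ?_, ?_, by simp [φ], by simp [ψ], ?_, ?_⟩
  · intro x y hxy k l hk hl
    by_cases hx : x = A.leaf
    · simp [φ, hx] at hk
    by_cases hy : y = A.leaf
    · simp [φ, hy] at hl
    simp only [φ, dif_neg hx] at hk
    simp only [φ, dif_neg hy] at hl
    exact hχ (u := .inl ⟨x, hx⟩) (v := .inl ⟨y, hy⟩) hxy hk hl
  · intro x y hxy k l hk hl
    by_cases hx : x = B.leaf
    · simp [ψ, hx] at hk
    by_cases hy : y = B.leaf
    · simp [ψ, hy] at hl
    by_cases hx' : x = B.nbr <;> by_cases hy' : y = B.nbr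
    · rw [hx', hy'] at hxy
      exact (B.graph.irrefl hxy).elim
    · rw [hx', hψn] at hk
      simp only [ψ, dif_neg hy, dif_neg hy'] at hl
      exact hχ (u := .inl ⟨A.nbr, A.nbr_ne_leaf⟩) (v := .inr ⟨y, hy, hy'⟩) ⟨rfl, hx' ▸ hxy⟩ hk hl
    · rw [hy', hψn] at hl
      simp only [ψ, dif_neg hx, dif_neg hx'] at hk
      exact hχ (u := .inr ⟨x, hx, hx'⟩) (v := .inl ⟨A.nbr, A.nbr_ne_leaf⟩)
        ⟨rfl, hy' ▸ hxy.symm⟩ hk hl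
    · simp only [ψ, dif_neg hx, dif_neg hx'] at hk
      simp only [ψ, dif_neg hy, dif_neg hy'] at hl
      exact hχ (u := .inr ⟨x, hx, hx'⟩) (v := .inr ⟨y, hy, hy'⟩) hxy hk hl
  · rw [hψn]
    simp only [φ, dif_neg A.nbr_ne_leaf]
  · funext z
    rcases z with ⟨x, hx⟩ | ⟨y, hy, hy'⟩
    · simp [glue, φ, hx]
    · simp [glue, ψ, hy, hy']

variable [Finite A.V] [Finite B.V]

/-- The two leaves disappear, and the identified vertex is counted twice on the right hand side
if it is removed. -/
theorem cut_ncard_glue (hφ : φ A.leaf = none) (hψ : ψ B.leaf = none) :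
    (cut (glue φ ψ)).ncard + 2 + (cut ψ ∩ {B.nbr}).ncard = (cut φ).ncard + (cut ψ).ncard := by
  have h1 : cut (glue φ ψ) = Sum.inl '' {x : {x : A.V // x ≠ A.leaf} | φ x = none} ∪
      Sum.inr '' {y : {y : B.V // y ≠ B.leaf ∧ y ≠ B.nbr} | ψ y = none} := by
    ext (x | y) <;> simp [cut, glue]
  have h2 : cut φ = insert A.leaf (Subtype.val '' {x : {x : A.V // x ≠ A.leaf} | φ x = none}) := by
    ext x
    by_cases hx : x = A.leaf
    · simp [cut, hx, hφ]
    · simp [cut, hx]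
  have h3 : cut ψ = insert B.leaf
      (Subtype.val '' {y : {y : B.V // y ≠ B.leaf ∧ y ≠ B.nbr} | ψ y = none} ∪
        (cut ψ ∩ {B.nbr})) := by
    ext y
    by_cases hy : y = B.leaf
    · simp [cut, hy, hψ]
    by_cases hy' : y = B.nbr
    · simp [cut, hy', B.nbr_ne_leaf]
    · simp [cut, hy, hy']
  have h1' := congrArg Set.ncard h1
  have h2' := congrArg Set.ncard h2
  have h3' := congrArg Set.ncard h3
  rw [Set.ncard_union_eq (by simp [Set.disjoint_left]),
    Set.ncard_image_of_injective _ Sum.inl_injective,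
    Set.ncard_image_of_injective _ Sum.inr_injective] at h1'
  rw [Set.ncard_insert_of_notMem (by simp),
    Set.ncard_image_of_injective _ Subtype.val_injective] at h2'
  rw [Set.ncard_insert_of_notMem (by simp [B.nbr_ne_leaf.symm]), Set.ncard_union_eq
    (by simp +contextual [Set.disjoint_left]),
    Set.ncard_image_of_injective _ Subtype.val_injective] at h3'
  omega

/-- The weight of a glued labelling: if the identified vertex is removed, then it is counted only
once, and if it is kept, then its two classes are merged. -/
theorem weight_glue (b : ℤ) (hφ : φ A.leaf = none) (hψ : ψ B.leaf = none)
    (h : φ A.nbr = ψ B.nbr) :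
    weight b (glue φ ψ) = (weight b φ + 1) + (weight b ψ + 1) + (cut ψ ∩ {B.nbr}).ncard
      - (b + 1) * (labels φ ∩ labels ψ).ncard := by
  have h1 : ((cut (glue φ ψ)).ncard : ℤ) + 2 + (cut ψ ∩ {B.nbr}).ncard =
    (cut φ).ncard + (cut ψ).ncard := mod_cast cut_ncard_glue hφ hψ
  have h2 : ((labels φ ∪ labels ψ).ncard : ℤ) + (labels φ ∩ labels ψ).ncard =
    (labels φ).ncard + (labels ψ).ncard := mod_cast
      Set.ncard_union_add_ncard_inter _ _ (labels_finite φ) (labels_finite ψ)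
  rw [weight, weight, weight, labels_glue hφ hψ h]
  linear_combination (b + 1) * h2 - h1

theorem weight_glue_le_of_cut {b : ℤ} (hb : 0 ≤ b) (hφ : φ A.leaf = none) (hψ : ψ B.leaf = none)
    (h : φ A.nbr = ψ B.nbr) (hn : φ A.nbr = none) {x : ℤ} (hx : weight b φ + 1 ≤ x) :
    weight b (glue φ ψ) ≤ x + (weight b ψ + 1) + 1 := by
  rw [weight_glue b hφ hψ h]
  have h1 : cut ψ ∩ {B.nbr} = {B.nbr} := by
    rw [Set.inter_eq_right, Set.singleton_subset_iff]
    exact h.symm.trans hn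
  have h2 : 0 ≤ (b + 1) * (labels φ ∩ labels ψ).ncard := by positivity
  rw [h1, Set.ncard_singleton]
  push_cast
  linarith

theorem weight_glue_le_of_kept {b : ℤ} (hb : 0 ≤ b) (hφ : φ A.leaf = none)
    (hψ : ψ B.leaf = none) (h : φ A.nbr = ψ B.nbr) (hn : φ A.nbr ≠ none) {x : ℤ}
    (hx : weight b φ + 1 ≤ x) :
    weight b (glue φ ψ) ≤ x + (weight b ψ + 1) - (b + 1) := by
  rw [weight_glue b hφ hψ h]
  have h1 : cut ψ ∩ {B.nbr} = ∅ := by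
    rw [Set.inter_singleton_eq_empty]
    exact fun hB ↦ hn (h.trans hB)
  obtain ⟨l, hl⟩ := Option.ne_none_iff_exists'.1 hn
  have h2 : 1 ≤ (labels φ ∩ labels ψ).ncard :=
    (Set.ncard_pos ((labels_finite φ).inter_of_left _)).2 ⟨l, ⟨_, hl⟩, ⟨_, h ▸ hl⟩⟩
  have h3 : (b + 1) * 1 ≤ (b + 1) * (labels φ ∩ labels ψ).ncard :=
    mul_le_mul_of_nonneg_left (mod_cast h2) (by linarith)
  rw [h1, Set.ncard_empty]
  push_cast
  linarith

end

section

variable [Finite A.V] [Finite B.V] {φ : A.V → Option ℕ} {ψ : B.V → Option ℕ}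

/-- Labellings of `A` and `B` that remove the neighbours of both leaves can be glued without
identifying labels. -/
theorem exists_glue_of_cut (b : ℤ) (hφ : IsLabelling A.graph φ) (hψ : IsLabelling B.graph ψ)
    (hφ' : φ A.leaf = none) (hψ' : ψ B.leaf = none) (hφn : φ A.nbr = none)
    (hψn : ψ B.nbr = none) {x y : ℤ} (hx : weight b φ + 1 = x) (hy : weight b ψ + 1 = y) :
    ∃ ψ' : B.V → Option ℕ, IsLabelling (circGraph A B) (glue φ ψ') ∧
      weight b (glue φ ψ') = x + y + 1 := by
  obtain ⟨N, hN⟩ := (labels_finite φ).bddAbove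
  -- Shifting the labels of `ψ` makes them different from those of `φ`.
  let g : ℕ → ℕ := fun l ↦ l + (N + 1)
  have hg : Function.Injective g := fun x y hxy ↦ by simpa [g] using hxy
  have h : φ A.nbr = (ψ B.nbr).map g := by simp [hφn, hψn]
  refine ⟨fun v ↦ (ψ v).map g, isLabelling_glue hφ (hψ.map g) h, ?_⟩
  rw [weight_glue b hφ' (by simp [hψ']) h, weight_map b ψ hg.injOn, labels_map, hx, hy]
  have h1 : cut (fun v ↦ (ψ v).map g) ∩ {B.nbr} = {B.nbr} := by
    simp [cut, hψn]
  have h2 : labels φ ∩ g '' labels ψ = ∅ := by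
    ext l
    simp only [Set.mem_inter_iff, Set.mem_image, Set.mem_empty_iff_false, iff_false]
    rintro ⟨hl, k, -, rfl⟩
    have := hN hl
    simp only [g] at this
    omega
  simp [h1, h2]

/-- Labellings of `A` and `B` that keep the neighbours of both leaves can be glued such that only
the labels of these neighbours are identified. -/
theorem exists_glue_of_kept (b : ℤ) (hφ : IsLabelling A.graph φ) (hψ : IsLabelling B.graph ψ)
    (hφ' : φ A.leaf = none) (hψ' : ψ B.leaf = none) (hφn : φ A.nbr ≠ none)
    (hψn : ψ B.nbr ≠ none) {x y : ℤ} (hx : weight b φ + 1 = x) (hy : weight b ψ + 1 = y) :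
    ∃ ψ' : B.V → Option ℕ, IsLabelling (circGraph A B) (glue φ ψ') ∧
      weight b (glue φ ψ') = x + y - (b + 1) := by
  obtain ⟨N, hN⟩ := (labels_finite φ).bddAbove
  obtain ⟨k, hk⟩ := Option.ne_none_iff_exists'.1 hφn
  obtain ⟨l, hl⟩ := Option.ne_none_iff_exists'.1 hψn
  have hkN : k ≤ N := hN ⟨_, hk⟩
  let g : ℕ → ℕ := fun x ↦ if x = l then k else x + (N + 1)
  have hg : Function.Injective g := fun x y hxy ↦ by
    simp only [g] at hxy
    split_ifs at hxy <;> omega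
  have h : φ A.nbr = (ψ B.nbr).map g := by simp [hk, hl, g]
  refine ⟨fun v ↦ (ψ v).map g, isLabelling_glue hφ (hψ.map g) h, ?_⟩
  rw [weight_glue b hφ' (by simp [hψ']) h, weight_map b ψ hg.injOn, labels_map, hx, hy]
  have h1 : cut (fun v ↦ (ψ v).map g) ∩ {B.nbr} = ∅ := by
    simp [cut, hl]
  have h2 : labels φ ∩ g '' labels ψ = {k} := by
    ext x
    simp only [Set.mem_inter_iff, Set.mem_image, Set.mem_singleton_iff]
    constructor
    · rintro ⟨hx, y, -, rfl⟩
      have := hN hx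
      simp only [g] at this ⊢
      split_ifs at this ⊢
      · rfl
      · omega
    · rintro rfl
      exact ⟨⟨_, hk⟩, l, ⟨_, hl⟩, by simp [g]⟩
  simp [h1, h2]

end

end LeafGraph

/-! ### Labellings of `F_p` -/

section graphF

variable {p : ℕ}

@[simp]
theorem graphF_adj_inl_inr {i j : Fin p} : (graphF p).Adj (.inl i) (.inr j) ↔ i ≤ j := Iff.rfl

@[simp]
theorem graphF_adj_inr_inl {i j : Fin p} : (graphF p).Adj (.inr j) (.inl i) ↔ i ≤ j := Iff.rfl

@[simp]
theorem graphF_adj_inl_inl {i j : Fin p} : ¬ (graphF p).Adj (.inl i) (.inl j) := id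

@[simp]
theorem graphF_adj_inr_inr {i j : Fin p} : ¬ (graphF p).Adj (.inr i) (.inr j) := id

/-- The symmetry of `F_p` that exchanges its two leaves. -/
def graphFMirror (p : ℕ) : graphF p ≃g graphF p where
  toEquiv := (Equiv.sumComm _ _).trans (Equiv.sumCongr Fin.revPerm Fin.revPerm)
  map_rel_iff' := by
    rintro (i | i) (j | j) <;> simp

/-- The perfect matching `{2i, 2i-1}` shows that there are at most `p` labels. -/
theorem graphF_labels_ncard_le (hp : 0 < p) {φ : Fin p ⊕ Fin p → Option ℕ}
    (h : IsLabelling (graphF p) φ) :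
    (labels φ).ncard ≤ p := by
  have : Nonempty (Fin p ⊕ Fin p) := ⟨.inl ⟨0, hp⟩⟩
  choose! x hx using fun l (hl : l ∈ labels φ) ↦ hl
  have := Set.ncard_le_ncard_of_injOn (s := labels φ) (t := Set.univ)
    (fun l ↦ Sum.elim id id (x l)) (fun _ _ ↦ Set.mem_univ _) (by
      have key : ∀ u v : Fin p ⊕ Fin p, Sum.elim id id u = Sum.elim id id v →
          ∀ k l, φ u = some k → φ v = some l → k = l := by
        rintro (i | i) (j | j) (rfl : i = j) k l h1 h2
        · exact Option.some_inj.1 (h1.symm.trans h2)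
        · exact h (graphF_adj_inl_inr.2 le_rfl) h1 h2
        · exact h (graphF_adj_inr_inl.2 le_rfl) h1 h2
        · exact Option.some_inj.1 (h1.symm.trans h2)
      exact fun k hk l hl hkl ↦ key _ _ hkl k l (hx k hk) (hx l hl))
  simpa using this

/-- At most one label occurs at both ends of an edge of the perfect matching `{2i, 2i-1}`; every
other label yields a removed vertex, matched to a vertex with that label. -/
theorem graphF_labels_ncard_le_cut (hp : 0 < p) {φ : Fin p ⊕ Fin p → Option ℕ}
    (h : IsLabelling (graphF p) φ) : (labels φ).ncard ≤ (cut φ).ncard + 1 := by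
  have : Nonempty (Fin p ⊕ Fin p) := ⟨.inl ⟨0, hp⟩⟩
  choose! x hx using fun l (hl : l ∈ labels φ) ↦ hl
  have hadj : ∀ v, (graphF p).Adj v v.swap := by rintro (i | i) <;> simp
  let M : Set ℕ := {l ∈ labels φ | φ (x l).swap ≠ none}
  have hM : M.ncard ≤ 1 := by
    have : Finite M := (labels_finite φ).subset fun _ hl ↦ hl.1
    refine Set.ncard_le_one_iff_subsingleton.2 ?_
    have key : ∀ k ∈ M, ∃ i, φ (.inl i) = some k ∧ φ (.inr i) = some k := by
      rintro k ⟨hk, hk'⟩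
      obtain ⟨l, hl⟩ := Option.ne_none_iff_exists'.1 hk'
      obtain rfl := h (hadj (x k)) (hx k hk) hl
      have hk1 := hx k hk
      generalize x k = u at hk1 hl
      rcases u with i | i
      · exact ⟨i, hk1, hl⟩
      · exact ⟨i, hl, hk1⟩
    intro k hk l hl
    obtain ⟨i, hi, hi'⟩ := key k hk
    obtain ⟨j, hj, hj'⟩ := key l hl
    rcases le_total i j with hij | hij
    · exact h (graphF_adj_inl_inr.2 hij) hi hj'
    · exact h (graphF_adj_inr_inl.2 hij) hi' hj
  have hN : (labels φ \ M).ncard ≤ (cut φ).ncard := by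
    refine Set.ncard_le_ncard_of_injOn (fun l ↦ (x l).swap) ?_ ?_
    · rintro l ⟨hl, hl'⟩
      by_contra hc
      exact hl' ⟨hl, hc⟩
    · rintro k ⟨hk, -⟩ l ⟨hl, -⟩ hkl
      have : x k = x l := Sum.swap_leftInverse.injective hkl
      exact Option.some_inj.1 ((hx k hk).symm.trans (this ▸ hx l hl))
  have := Set.ncard_sdiff_add_ncard_of_subset (s := M) (t := labels φ) (fun _ hl ↦ hl.1)
    (labels_finite φ)
  omega

theorem graphF_weight_le (hp : 0 < p) {b : ℤ} (hb : 0 ≤ b) {φ : Fin p ⊕ Fin p → Option ℕ}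
    (h : IsLabelling (graphF p) φ) : weight b φ ≤ b * p + 1 := by
  have h1 : ((labels φ).ncard : ℤ) ≤ p := mod_cast graphF_labels_ncard_le hp h
  have h2 : ((labels φ).ncard : ℤ) ≤ (cut φ).ncard + 1 := mod_cast graphF_labels_ncard_le_cut hp h
  have h3 := mul_le_mul_of_nonneg_left h1 hb
  rw [weight]
  linarith

/-- If both neighbours of the leaves are present, then what remains is connected. -/
theorem graphF_labels_ncard_le_one {φ : Fin p ⊕ Fin p → Option ℕ}
    (h : IsLabelling (graphF p) φ) (hp : 0 < p) (h0 : φ (.inl ⟨0, hp⟩) ≠ none)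
    (h1 : φ (.inr ⟨p - 1, by omega⟩) ≠ none) : (labels φ).ncard ≤ 1 := by
  have := (labels_finite φ).to_subtype
  obtain ⟨k, hk⟩ := Option.ne_none_iff_exists'.1 h0
  obtain ⟨l, hl⟩ := Option.ne_none_iff_exists'.1 h1
  obtain rfl : k = l := h (graphF_adj_inl_inr.2 (by simp [Fin.le_def])) hk hl
  have key : ∀ l ∈ labels φ, l = k := by
    rintro l ⟨i | i, hi⟩
    · exact h (graphF_adj_inl_inr.2 (by simp only [Fin.le_def]; omega)) hi hl
    · exact h (graphF_adj_inr_inl.2 (by simp [Fin.le_def])) hi hk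
  exact Set.ncard_le_one_iff_subsingleton.2 fun x hx y hy ↦ (key x hx).trans (key y hy).symm

open Classical in
/-- The labelling of `F_p` that keeps the vertices `2i` with `i ∈ P`, each as a class of its
own. -/
noncomputable def evenLabelling (P : Set (Fin p)) : Fin p ⊕ Fin p → Option ℕ :=
  Sum.elim (fun i ↦ if i ∈ P then some i.1 else none) fun _ ↦ none

theorem isLabelling_evenLabelling (P : Set (Fin p)) :
    IsLabelling (graphF p) (evenLabelling P) := by
  rintro (i | i) (j | j) hij k l hk hl <;> simp_all [evenLabelling]

theorem mem_labels_evenLabelling {P : Set (Fin p)} {i : Fin p} (hi : i ∈ P) :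
    i.1 ∈ labels (evenLabelling P) :=
  ⟨.inl i, by simp [evenLabelling, hi]⟩

theorem weight_evenLabelling (b : ℤ) (P : Set (Fin p)) :
    weight b (evenLabelling P) = (b + 2) * P.ncard - 2 * p := by
  have h1 : labels (evenLabelling P) = Fin.val '' P := by
    ext l
    constructor
    · rintro ⟨i | i, hi⟩
      · by_cases hP : i ∈ P
        · exact ⟨i, hP, by simpa [evenLabelling, hP] using hi⟩
        · simp [evenLabelling, hP] at hi
      · simp [evenLabelling] at hi
    · rintro ⟨i, hi, rfl⟩
      exact mem_labels_evenLabelling hi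
  have h2 : cut (evenLabelling P) = Sum.inl '' Pᶜ ∪ Set.range Sum.inr := by
    ext (i | i) <;> simp [cut, evenLabelling]
  have h3 : (Set.range (Sum.inr : Fin p → Fin p ⊕ Fin p)).ncard = p := by
    rw [← Set.image_univ, Set.ncard_image_of_injective _ Sum.inr_injective]
    simp
  have h4 : (P.ncard : ℤ) + Pᶜ.ncard = p := by
    have := Set.ncard_add_ncard_compl P
    rw [Nat.card_fin] at this
    exact_mod_cast this
  rw [weight, h1, h2, Set.ncard_image_of_injective _ Fin.val_injective,
    Set.ncard_union_eq (by simp [Set.disjoint_left]) , h3,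
    Set.ncard_image_of_injective _ Sum.inl_injective]
  push_cast
  linear_combination -h4

/-- The vertex `2j-1` may join the class of `2c` if the latter is its only remaining neighbour. -/
theorem exists_evenLabelling_insert (b : ℤ) (P : Set (Fin p)) (j c : Fin p) (hc : c ∈ P)
    (h : ∀ i ∈ P, i ≤ j → i = c) :
    ∃ φ : Fin p ⊕ Fin p → Option ℕ, IsLabelling (graphF p) φ ∧
      weight b φ = (b + 2) * P.ncard - 2 * p + 1 ∧ (∀ i, φ (.inl i) = none ↔ i ∉ P) ∧
      ∀ i, φ (.inr i) = none ↔ i ≠ j := by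
  classical
  refine ⟨Function.update (evenLabelling P) (.inr j) (some c.1),
    (isLabelling_evenLabelling P).update_some ?_, ?_, ?_, ?_⟩
  · rintro (i | i) hi k hk
    · by_cases hP : i ∈ P
      · rw [h i hP hi] at hk
        simpa [evenLabelling, hc, eq_comm] using hk
      · simp [evenLabelling, hP] at hk
    · simp at hi
  · rw [weight_update_some_of_mem b (by simp [evenLabelling]) (mem_labels_evenLabelling hc),
      weight_evenLabelling]
  · intro i
    by_cases hP : i ∈ P <;> simp [evenLabelling, hP]
  · intro i
    rcases eq_or_ne i j with rfl | hij
    · simp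
    · simp [evenLabelling, hij]

theorem isMaxWeight_graphF {b : ℤ} (hb : 0 ≤ b) (hp : 0 < p) :
    IsMaxWeight b (graphF p) (b * p + 1) := by
  refine ⟨?_, ?_⟩
  · obtain ⟨φ, hφ, hw, -⟩ := exists_evenLabelling_insert b (Set.univ : Set (Fin p)) ⟨0, hp⟩
      ⟨0, hp⟩ (Set.mem_univ _) (fun i _ hi ↦ by ext; simpa [Fin.le_def] using hi)
    refine ⟨φ, hφ, ?_⟩
    rw [hw, Set.ncard_univ, Nat.card_fin]
    ring
  · rintro _ ⟨φ, hφ, rfl⟩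
    exact graphF_weight_le hp hb hφ

/-- The first index, `0 : Fin p`. -/
abbrev idxFst (hp : 0 < p) : Fin p := ⟨0, hp⟩

/-- The last index, `p - 1 : Fin p`. -/
abbrev idxLst (hp : 0 < p) : Fin p := ⟨p - 1, by omega⟩

theorem graphFMirror_inl (i : Fin p) : graphFMirror p (.inl i) = .inr i.rev := rfl

theorem graphFMirror_inr (i : Fin p) : graphFMirror p (.inr i) = .inl i.rev := rfl

theorem rev_idxFst (hp : 0 < p) : (idxFst hp).rev = idxLst hp := by
  ext
  simp [Fin.val_rev]

theorem rev_idxLst (hp : 0 < p) : (idxLst hp).rev = idxFst hp := by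
  rw [← rev_idxFst, Fin.rev_rev]

theorem ncard_ne_idxLst (hp : 0 < p) : ({i | i ≠ idxLst hp} : Set (Fin p)).ncard + 1 = p := by
  have : ({i | i ≠ idxLst hp} : Set (Fin p)) = {idxLst hp}ᶜ := rfl
  rw [this, add_comm, ← Set.ncard_singleton (idxLst hp), Set.ncard_add_ncard_compl, Nat.card_fin]

theorem ncard_ne_idxFst_idxLst (hp : 2 ≤ p) : ({i | i ≠ idxFst (by omega) ∧
    i ≠ idxLst (by omega)} : Set (Fin p)).ncard + 2 = p := by
  have : ({i | i ≠ idxFst (by omega) ∧ i ≠ idxLst (by omega)} : Set (Fin p)) =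
      {idxFst (by omega), idxLst (by omega)}ᶜ := by
    ext i
    simp
  rw [this, add_comm, ← Set.ncard_pair (a := idxFst (p := p) (by omega))
    (b := idxLst (by omega)) (by simp only [ne_eq, Fin.mk.injEq]; omega),
    Set.ncard_add_ncard_compl, Nat.card_fin]

variable {b : ℤ}

/-! ### Labellings of `F_p` that remove one or both leaves -/

/-!
In the names below, `lst_kept` and `lst_cut` say that the leaf `2p` is removed, and whether its
neighbour `2p-1` is kept. The suffixes `kept_kept`, `kept_cut`, `cut_kept`, `cut_cut` say that both
leaves `1` and `2p` are removed, and whether their neighbours `2` and `2p-1`, in this order, are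
kept.
-/

/-- Keep the vertices `2, 4, …, 2p-2` as separate classes, with `1` in the class of `2`. -/
theorem exists_graphF_lst_cut (b : ℤ) (hp : 2 ≤ p) :
    ∃ φ : Fin p ⊕ Fin p → Option ℕ, IsLabelling (graphF p) φ ∧
      φ (.inl (idxLst (by omega))) = none ∧ φ (.inr (idxLst (by omega))) = none ∧
      weight b φ + 1 = b * (p - 1) := by
  obtain ⟨φ, hφ, hw, h1, h2⟩ := exists_evenLabelling_insert b
    ({i | i ≠ idxLst (by omega)} : Set (Fin p)) (idxFst (by omega)) (idxFst (by omega))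
    (by simp only [Set.mem_ofPred_eq, ne_eq, Fin.mk.injEq]; omega)
    (fun i _ hi ↦ by ext; simpa [Fin.le_def] using hi)
  refine ⟨φ, hφ, by simp [h1], ?_, ?_⟩
  · rw [h2]
    simp only [ne_eq, Fin.mk.injEq]
    omega
  · have : (({i | i ≠ idxLst (by omega)} : Set (Fin p)).ncard : ℤ) + 1 = p :=
      mod_cast ncard_ne_idxLst (by omega)
    rw [hw]
    linear_combination (b + 2) * this

/-- Keep the vertices `1, 3, …, 2p-1` as separate classes. -/
theorem exists_graphF_lst_kept (b : ℤ) (hp : 0 < p) :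
    ∃ φ : Fin p ⊕ Fin p → Option ℕ, IsLabelling (graphF p) φ ∧
      φ (.inl (idxLst hp)) = none ∧ φ (.inr (idxLst hp)) ≠ none ∧
      weight b φ + 1 = b * p + 1 := by
  refine ⟨_, (isLabelling_evenLabelling Set.univ).comp_hom (graphFMirror p).toHom, ?_, ?_, ?_⟩
  · simp [graphFMirror_inl, evenLabelling]
  · simp [graphFMirror_inr, evenLabelling]
  · have := weight_comp_equiv b (graphFMirror p).toEquiv (evenLabelling Set.univ)
    refine (congrArg (· + 1) this).trans ?_
    simp only [weight_evenLabelling, Set.ncard_univ, Nat.card_fin]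
    ring

/-- Keep the vertices `2, 4, …, 2p-2` as separate classes. -/
theorem exists_graphF_kept_cut (b : ℤ) (hp : 2 ≤ p) :
    ∃ φ : Fin p ⊕ Fin p → Option ℕ, IsLabelling (graphF p) φ ∧
      φ (.inl (idxLst (by omega))) = none ∧ φ (.inr (idxFst (by omega))) = none ∧
      φ (.inl (idxFst (by omega))) ≠ none ∧ φ (.inr (idxLst (by omega))) = none ∧
      weight b φ + 1 = b * (p - 1) - 1 := by
  refine ⟨_, isLabelling_evenLabelling {i | i ≠ idxLst (by omega)}, ?_, ?_, ?_, ?_, ?_⟩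
  · simp [evenLabelling]
  · simp [evenLabelling]
  · have : 0 ≠ p - 1 := by omega
    simp [evenLabelling, this]
  · simp [evenLabelling]
  · have : (({i | i ≠ idxLst (by omega)} : Set (Fin p)).ncard : ℤ) + 1 = p :=
      mod_cast ncard_ne_idxLst (by omega)
    rw [weight_evenLabelling]
    linear_combination (b + 2) * this

/-- Keep the vertices `3, 5, …, 2p-1` as separate classes. -/
theorem exists_graphF_cut_kept (b : ℤ) (hp : 2 ≤ p) :
    ∃ φ : Fin p ⊕ Fin p → Option ℕ, IsLabelling (graphF p) φ ∧
      φ (.inl (idxLst (by omega))) = none ∧ φ (.inr (idxFst (by omega))) = none ∧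
      φ (.inl (idxFst (by omega))) = none ∧ φ (.inr (idxLst (by omega))) ≠ none ∧
      weight b φ + 1 = b * (p - 1) - 1 := by
  obtain ⟨φ, hφ, h1, h2, h3, h4, hw⟩ := exists_graphF_kept_cut b hp
  refine ⟨_, hφ.comp_hom (graphFMirror p).toHom, ?_, ?_, ?_, ?_,
    (congrArg (· + 1) (weight_comp_equiv b (graphFMirror p).toEquiv φ)).trans hw⟩
  · exact (congrArg (fun i ↦ φ (.inr i)) (rev_idxLst _)).trans h2
  · exact (congrArg (fun i ↦ φ (.inl i)) (rev_idxFst _)).trans h1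
  · exact (congrArg (fun i ↦ φ (.inr i)) (rev_idxFst _)).trans h4
  · exact fun h ↦ h3 ((congrArg (fun i ↦ φ (.inl i)) (rev_idxLst _)).symm.trans h)

/-- Keep the vertices `4, 6, …, 2p-2` as separate classes, with `3` in the class of `4`. -/
theorem exists_graphF_cut_cut (b : ℤ) (hp : 3 ≤ p) :
    ∃ φ : Fin p ⊕ Fin p → Option ℕ, IsLabelling (graphF p) φ ∧
      φ (.inl (idxLst (by omega))) = none ∧ φ (.inr (idxFst (by omega))) = none ∧
      φ (.inl (idxFst (by omega))) = none ∧ φ (.inr (idxLst (by omega))) = none ∧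
      weight b φ + 1 = b * (p - 2) - 2 := by
  obtain ⟨φ, hφ, hw, h1, h2⟩ := exists_evenLabelling_insert b
    ({i | i ≠ idxFst (by omega) ∧ i ≠ idxLst (by omega)} : Set (Fin p)) ⟨1, by omega⟩
    ⟨1, by omega⟩
    (by simp only [Set.mem_ofPred_eq, ne_eq, Fin.mk.injEq]; omega)
    (fun i hi hi' ↦ by
      simp only [Set.mem_ofPred_eq, ne_eq, Fin.ext_iff] at hi
      simp only [Fin.le_def] at hi'
      ext
      dsimp only
      omega)
  refine ⟨φ, hφ, by simp [h1], ?_, by simp [h1], ?_, ?_⟩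
  · rw [h2]
    simp
  · rw [h2]
    simp only [ne_eq, Fin.mk.injEq]
    omega
  · have : (({i | i ≠ idxFst (by omega) ∧ i ≠ idxLst (by omega)} : Set (Fin p)).ncard : ℤ) + 2
        = p := mod_cast ncard_ne_idxFst_idxLst (by omega)
    rw [hw]
    linear_combination (b + 2) * this

variable {φ : Fin p ⊕ Fin p → Option ℕ}

/-- Put the leaf back, and use that no labelling of `F_p` has weight more than `b p + 1`. The
following bounds have the same reason, except where both neighbours of the leaves are kept. -/
theorem graphF_weight_le_of_lst_kept (hb : 0 ≤ b) (hp : 0 < p) (h : IsLabelling (graphF p) φ)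
    (h1 : φ (.inl (idxLst hp)) = none) (h2 : φ (.inr (idxLst hp)) ≠ none) :
    weight b φ + 1 ≤ b * p + 1 := by
  obtain ⟨ψ, hψ, hw, -⟩ := h.exists_weight_add_one (graphF_neighborSet_last hp) h1 h2 b
  have := graphF_weight_le hp hb hψ
  linarith

theorem graphF_weight_le_of_lst_cut (hb : 0 ≤ b) (hp : 0 < p) (h : IsLabelling (graphF p) φ)
    (h1 : φ (.inl (idxLst hp)) = none) (h2 : φ (.inr (idxLst hp)) = none) :
    weight b φ + 1 ≤ b * (p - 1) := by
  obtain ⟨ψ, hψ, hw, -⟩ := h.exists_weight_add (graphF_neighborSet_last hp) h1 h2 b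
  have := graphF_weight_le hp hb hψ
  linarith

variable (hp : 2 ≤ p) (h : IsLabelling (graphF p) φ)
  (h1 : φ (.inl (idxLst (by omega))) = none) (h2 : φ (.inr (idxFst (by omega))) = none)

include hp h h1 h2

/-- Here only one class remains. -/
theorem graphF_weight_le_of_kept_kept (hb : 0 ≤ b) (h3 : φ (.inl (idxFst (by omega))) ≠ none)
    (h4 : φ (.inr (idxLst (by omega))) ≠ none) : weight b φ + 1 ≤ b := by
  have h5 : ((labels φ).ncard : ℤ) ≤ 1 :=
    mod_cast graphF_labels_ncard_le_one h (by omega) h3 h4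
  have h6 : (2 : ℤ) ≤ (cut φ).ncard := by
    have h7 : ({.inl (idxLst (by omega)), .inr (idxFst (by omega))} : Set (Fin p ⊕ Fin p)) ⊆
        cut φ := Set.pair_subset h1 h2
    have h8 := Set.ncard_le_ncard h7
    rw [Set.ncard_pair (by simp)] at h8
    exact_mod_cast h8
  rw [weight]
  have := mul_le_mul_of_nonneg_left h5 (by linarith : 0 ≤ b + 1)
  linarith

theorem graphF_weight_le_of_kept_cut (hb : 0 ≤ b) (h3 : φ (.inl (idxFst (by omega))) ≠ none)
    (h4 : φ (.inr (idxLst (by omega))) = none) : weight b φ + 1 ≤ b * (p - 1) - 1 := by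
  obtain ⟨ψ, hψ, hw, hψφ⟩ :=
    h.exists_weight_add_one (graphF_neighborSet_first (by omega)) h2 h3 b
  have := graphF_weight_le_of_lst_cut hb (by omega) hψ ((hψφ _ (by simp)).trans h1)
    ((hψφ _ (by simp only [ne_eq, Sum.inr.injEq, Fin.mk.injEq]; omega)).trans h4)
  linarith

theorem graphF_weight_le_of_cut_kept (hb : 0 ≤ b) (h3 : φ (.inl (idxFst (by omega))) = none)
    (h4 : φ (.inr (idxLst (by omega))) ≠ none) : weight b φ + 1 ≤ b * (p - 1) - 1 := by
  obtain ⟨ψ, hψ, hw, hψφ⟩ :=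
    h.exists_weight_add (graphF_neighborSet_first (by omega)) h2 h3 b
  have := graphF_weight_le_of_lst_kept hb (by omega) hψ ((hψφ _ (by simp)).trans h1)
    (by rwa [hψφ _ (by simp only [ne_eq, Sum.inr.injEq, Fin.mk.injEq]; omega)])
  linarith

theorem graphF_weight_le_of_cut_cut (hb : 0 ≤ b) (h3 : φ (.inl (idxFst (by omega))) = none)
    (h4 : φ (.inr (idxLst (by omega))) = none) : weight b φ + 1 ≤ b * (p - 2) - 2 := by
  obtain ⟨ψ, hψ, hw, hψφ⟩ :=
    h.exists_weight_add (graphF_neighborSet_first (by omega)) h2 h3 b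
  have := graphF_weight_le_of_lst_cut hb (by omega) hψ ((hψφ _ (by simp)).trans h1)
    ((hψφ _ (by simp only [ne_eq, Sum.inr.injEq, Fin.mk.injEq]; omega)).trans h4)
  linarith

end graphF

/-! ### The recursion along a chain -/

namespace LeafGraph

/-- The values `weight b φ + 1` for labellings `φ` of `X` that remove the leaf and keep its
neighbour. These are the weights of the labellings of `X` without its leaf. -/
def keptWeights (b : ℤ) (X : LeafGraph) : Set ℤ :=
  {x | ∃ φ : X.V → Option ℕ, IsLabelling X.graph φ ∧ φ X.leaf = none ∧ φ X.nbr ≠ none ∧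
    weight b φ + 1 = x}

/-- The values `weight b φ + 1` for labellings `φ` of `X` that remove the leaf and its
neighbour. -/
def cutWeights (b : ℤ) (X : LeafGraph) : Set ℤ :=
  {x | ∃ φ : X.V → Option ℕ, IsLabelling X.graph φ ∧ φ X.leaf = none ∧ φ X.nbr = none ∧
    weight b φ + 1 = x}

section prependF

variable {b : ℤ} {p : ℕ} (hp : 3 ≤ p) {X : LeafGraph} [Finite X.V]

instance (p : ℕ) (hp : 0 < p) : Finite (leafF p hp).V :=
  inferInstanceAs (Finite (Fin p ⊕ Fin p))

instance : Finite (prependF p hp X).V :=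
  inferInstanceAs (Finite (CircVertex (leafF p (by omega)) X))

/-- The alternatives are that the vertex at which `F_p` and `X` are glued is kept or removed. -/
theorem exists_of_mem_keptWeights_prependF (hb : 0 ≤ b) {x : ℤ}
    (hx : x ∈ keptWeights b (prependF p hp X)) :
    (∃ y ∈ keptWeights b X, x ≤ y) ∨ ∃ y ∈ cutWeights b X, x ≤ b * (p - 1) + 1 + y := by
  obtain ⟨χ, hχ, h1, h2, rfl⟩ := hx
  obtain ⟨φ, ψ, hφ, hψ, hφl, hψl, hn, rfl⟩ := exists_eq_glue hχ
  by_cases hc : φ (leafF p (by omega)).nbr = none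
  · refine .inr ⟨_, ⟨ψ, hψ, hψl, hn ▸ hc, rfl⟩, ?_⟩
    have h4 := graphF_weight_le_of_kept_cut (by omega) hφ hφl h1 hb h2 hc
    have h3 := weight_glue_le_of_cut hb hφl hψl hn hc h4
    exact (Int.add_le_add_right h3 1).trans (by linarith)
  · refine .inl ⟨_, ⟨ψ, hψ, hψl, hn ▸ hc, rfl⟩, ?_⟩
    have h4 := graphF_weight_le_of_kept_kept (by omega) hφ hφl h1 hb h2 hc
    have h3 := weight_glue_le_of_kept hb hφl hψl hn hc h4
    exact (Int.add_le_add_right h3 1).trans (by linarith)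

/-- The alternatives are that the vertex at which `F_p` and `X` are glued is kept or removed. -/
theorem exists_of_mem_cutWeights_prependF (hb : 0 ≤ b) {x : ℤ}
    (hx : x ∈ cutWeights b (prependF p hp X)) :
    (∃ y ∈ keptWeights b X, x ≤ b * (p - 2) - 1 + y) ∨
      ∃ y ∈ cutWeights b X, x ≤ b * (p - 2) + y := by
  obtain ⟨χ, hχ, h1, h2, rfl⟩ := hx
  obtain ⟨φ, ψ, hφ, hψ, hφl, hψl, hn, rfl⟩ := exists_eq_glue hχ
  by_cases hc : φ (leafF p (by omega)).nbr = none
  · refine .inr ⟨_, ⟨ψ, hψ, hψl, hn ▸ hc, rfl⟩, ?_⟩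
    have h4 := graphF_weight_le_of_cut_cut (by omega) hφ hφl h1 hb h2 hc
    have h3 := weight_glue_le_of_cut hb hφl hψl hn hc h4
    exact (Int.add_le_add_right h3 1).trans (by linarith)
  · refine .inl ⟨_, ⟨ψ, hψ, hψl, hn ▸ hc, rfl⟩, ?_⟩
    have h4 := graphF_weight_le_of_cut_kept (by omega) hφ hφl h1 hb h2 hc
    have h3 := weight_glue_le_of_kept hb hφl hψl hn hc h4
    exact (Int.add_le_add_right h3 1).trans (by linarith)

theorem mem_keptWeights_prependF_of_cut {y : ℤ} (hy : y ∈ cutWeights b X) :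
    b * (p - 1) + 1 + y ∈ keptWeights b (prependF p hp X) := by
  obtain ⟨ψ, hψ, hψl, hψn, rfl⟩ := hy
  obtain ⟨φ, hφ, h1, h2, h3, h4, hw⟩ := exists_graphF_kept_cut b (p := p) (by omega)
  obtain ⟨ψ', hl, hw'⟩ :=
    exists_glue_of_cut (A := leafF p (by omega)) (B := X) b hφ hψ h1 hψl h4 hψn hw rfl
  refine ⟨_, hl, h2, h3, ?_⟩
  exact (congrArg (· + 1) hw').trans (by ring)

theorem mem_cutWeights_prependF_of_cut {y : ℤ} (hy : y ∈ cutWeights b X) :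
    b * (p - 2) + y ∈ cutWeights b (prependF p hp X) := by
  obtain ⟨ψ, hψ, hψl, hψn, rfl⟩ := hy
  obtain ⟨φ, hφ, h1, h2, h3, h4, hw⟩ := exists_graphF_cut_cut b (p := p) hp
  obtain ⟨ψ', hl, hw'⟩ :=
    exists_glue_of_cut (A := leafF p (by omega)) (B := X) b hφ hψ h1 hψl h4 hψn hw rfl
  refine ⟨_, hl, h2, h3, ?_⟩
  exact (congrArg (· + 1) hw').trans (by ring)

theorem mem_cutWeights_prependF_of_kept {y : ℤ} (hy : y ∈ keptWeights b X) :
    b * (p - 2) - 1 + y ∈ cutWeights b (prependF p hp X) := by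
  obtain ⟨ψ, hψ, hψl, hψn, rfl⟩ := hy
  obtain ⟨φ, hφ, h1, h2, h3, h4, hw⟩ := exists_graphF_cut_kept b (p := p) (by omega)
  obtain ⟨ψ', hl, hw'⟩ :=
    exists_glue_of_kept (A := leafF p (by omega)) (B := X) b hφ hψ h1 hψl h4 hψn hw rfl
  refine ⟨_, hl, h2, h3, ?_⟩
  exact (congrArg (· + 1) hw').trans (by ring)

/-- The maximal weight of `F_p ∘ X` in terms of `X` without its leaf. -/
theorem isMaxWeight_prependF (hb : 0 ≤ b) {c : ℤ}
    (hk : ∀ y ∈ keptWeights b X, y ≤ c) (hc : ∀ y ∈ cutWeights b X, y + 1 ≤ c)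
    (h : c ∈ keptWeights b X ∨ c - 1 ∈ cutWeights b X) :
    IsMaxWeight b (prependF p hp X).graph (b * (p - 1) + c) := by
  refine ⟨?_, ?_⟩
  · rcases h with ⟨ψ, hψ, hψl, hψn, hy⟩ | ⟨ψ, hψ, hψl, hψn, hy⟩
    · obtain ⟨φ, hφ, h1, h2, hw⟩ := exists_graphF_lst_kept b (p := p) (by omega)
      obtain ⟨ψ', hl, hw'⟩ :=
        exists_glue_of_kept (A := leafF p (by omega)) (B := X) b hφ hψ h1 hψl h2 hψn hw hy
      exact ⟨_, hl, hw'.trans (by ring)⟩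
    · obtain ⟨φ, hφ, h1, h2, hw⟩ := exists_graphF_lst_cut b (p := p) (by omega)
      obtain ⟨ψ', hl, hw'⟩ :=
        exists_glue_of_cut (A := leafF p (by omega)) (B := X) b hφ hψ h1 hψl h2 hψn hw hy
      exact ⟨_, hl, hw'.trans (by ring)⟩
  · rintro _ ⟨χ, hχ, rfl⟩
    obtain ⟨φ, ψ, hφ, hψ, hφl, hψl, hn, rfl⟩ := exists_eq_glue hχ
    by_cases hc' : φ (leafF p (by omega)).nbr = none
    · have h4 := graphF_weight_le_of_lst_cut hb (by omega) hφ hφl hc'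
      have h3 := weight_glue_le_of_cut hb hφl hψl hn hc' h4
      have h5 := hc _ ⟨ψ, hψ, hψl, hn ▸ hc', rfl⟩
      exact h3.trans (by linarith)
    · have h4 := graphF_weight_le_of_lst_kept hb (by omega) hφ hφl hc'
      have h3 := weight_glue_le_of_kept hb hφl hψl hn hc' h4
      have h5 := hk _ ⟨ψ, hψ, hψl, hn ▸ hc', rfl⟩
      exact h3.trans (by linarith)

end prependF

/-- The marked graph `X` without its leaf has maximal weight `c` if the neighbour of the leaf is
kept, and `c - (b + 1)` if it is removed. -/
def IsKeptType (b : ℤ) (X : LeafGraph) (c : ℤ) : Prop :=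
  IsGreatest (keptWeights b X) c ∧ IsGreatest (cutWeights b X) (c - b - 1)

/-- The marked graph `X` without its leaf has maximal weight `c` if the neighbour of the leaf is
removed, and at most `c + 1` if it is kept. -/
def IsCutType (b : ℤ) (X : LeafGraph) (c : ℤ) : Prop :=
  IsGreatest (cutWeights b X) c ∧ ∀ x ∈ keptWeights b X, x ≤ c + 1

section

variable {b : ℤ} {p : ℕ} (hp : 3 ≤ p) {X : LeafGraph} [Finite X.V] {c : ℤ}

theorem IsKeptType.prependF (hb : 0 ≤ b) (h : IsKeptType b X c) :
    IsCutType b (prependF p hp X) (c + b * (p - 2) - 1) := by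
  have hp' : 0 ≤ b * ((p : ℤ) - 2) := mul_nonneg hb (by omega)
  refine ⟨⟨?_, ?_⟩, ?_⟩
  · have := mem_cutWeights_prependF_of_kept hp h.1.1
    convert! this using 1
    ring
  · intro x hx
    rcases exists_of_mem_cutWeights_prependF hp hb hx with ⟨y, hy, hxy⟩ | ⟨y, hy, hxy⟩
    · have := h.1.2 hy
      linarith
    · have := h.2.2 hy
      linarith
  · intro x hx
    rcases exists_of_mem_keptWeights_prependF hp hb hx with ⟨y, hy, hxy⟩ | ⟨y, hy, hxy⟩
    · have := h.1.2 hy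
      linarith
    · have := h.2.2 hy
      linarith

theorem IsCutType.prependF (hb : 0 ≤ b) (h : IsCutType b X c) :
    IsKeptType b (prependF p hp X) (c + b * (p - 1) + 1) := by
  have hp' : 0 ≤ b * ((p : ℤ) - 2) := mul_nonneg hb (by omega)
  refine ⟨⟨?_, ?_⟩, ?_, ?_⟩
  · have := mem_keptWeights_prependF_of_cut hp h.1.1
    convert! this using 1
    ring
  · intro x hx
    rcases exists_of_mem_keptWeights_prependF hp hb hx with ⟨y, hy, hxy⟩ | ⟨y, hy, hxy⟩
    · have := h.2 y hy
      linarith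
    · have := h.1.2 hy
      linarith
  · have := mem_cutWeights_prependF_of_cut hp h.1.1
    convert! this using 1
    ring
  · intro x hx
    rcases exists_of_mem_cutWeights_prependF hp hb hx with ⟨y, hy, hxy⟩ | ⟨y, hy, hxy⟩
    · have := h.2 y hy
      linarith
    · have := h.1.2 hy
      linarith

theorem IsKeptType.isMaxWeight_prependF (hb : 0 ≤ b) (h : IsKeptType b X c) :
    IsMaxWeight b (_root_.prependF p hp X).graph (b * (p - 1) + c) :=
  LeafGraph.isMaxWeight_prependF hp hb h.1.2
    (fun y hy ↦ by have := h.2.2 hy; linarith) (.inl h.1.1)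

theorem IsCutType.isMaxWeight_prependF (hb : 0 ≤ b) (h : IsCutType b X c) :
    IsMaxWeight b (_root_.prependF p hp X).graph (b * (p - 1) + (c + 1)) :=
  LeafGraph.isMaxWeight_prependF hp hb h.2
    (fun y hy ↦ by have := h.1.2 hy; linarith) (.inr (by simpa using h.1.1))

end

theorem card_circVertex (A B : LeafGraph) [Finite A.V] [Finite B.V] :
    Nat.card (CircVertex A B) + 3 = Nat.card A.V + Nat.card B.V := by
  have h1 : Nat.card {x : A.V // x ≠ A.leaf} + 1 = Nat.card A.V := by
    rw [add_comm, ← Set.ncard_singleton A.leaf]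
    exact Set.ncard_add_ncard_compl _
  have h2 : Nat.card {y : B.V // y ≠ B.leaf ∧ y ≠ B.nbr} + 2 = Nat.card B.V := by
    have h3 : Nat.card {y : B.V // y ≠ B.leaf ∧ y ≠ B.nbr} =
        ({B.leaf, B.nbr}ᶜ : Set B.V).ncard := by
      rw [← Nat.card_coe_set_eq]
      exact Nat.card_congr (Equiv.subtypeEquivRight fun y ↦ by simp)
    rw [h3, add_comm, ← Set.ncard_pair B.nbr_ne_leaf.symm, Set.ncard_add_ncard_compl]
  rw [CircVertex, Nat.card_sum]
  omega

theorem card_prependF {p : ℕ} (hp : 3 ≤ p) (X : LeafGraph) [Finite X.V] :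
    Nat.card (prependF p hp X).V + 3 = 2 * p + Nat.card X.V := by
  have h : Nat.card (leafF p (by omega)).V = 2 * p := by
    change Nat.card (Fin p ⊕ Fin p) = 2 * p
    rw [Nat.card_sum, Nat.card_fin]
    ring
  rw [← h]
  exact card_circVertex _ _

theorem finite_chainF (t : ℕ) (p : Fin t → ℕ) (hp : ∀ i, 3 ≤ p i) (X : LeafGraph)
    [hX : Finite X.V] : Finite (chainF t p hp X).V := by
  induction t with
  | zero => exact hX
  | succ t ih =>
    have := ih (fun i ↦ p i.succ) fun i ↦ hp i.succ
    exact inferInstanceAs (Finite (prependF (p 0) (hp 0) _).V)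

theorem card_chainF (t : ℕ) (p : Fin t → ℕ) (hp : ∀ i, 3 ≤ p i) (X : LeafGraph)
    [hX : Finite X.V] :
    (Nat.card (chainF t p hp X).V : ℤ) = 2 * ∑ i, (p i : ℤ) + Nat.card X.V - 3 * t := by
  induction t with
  | zero => simp [chainF]
  | succ t ih =>
    have := ih (fun i ↦ p i.succ) fun i ↦ hp i.succ
    have := finite_chainF t (fun i ↦ p i.succ) (fun i ↦ hp i.succ) X
    have h := card_prependF (hp 0) (chainF t (fun i ↦ p i.succ) (fun i ↦ hp i.succ) X)
    rw [chainF, Fin.sum_univ_succ]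
    push_cast
    linarith

variable {b : ℤ} (hb : 0 ≤ b) {t : ℕ} {p : Fin t → ℕ} (hp : ∀ i, 3 ≤ p i) {X : LeafGraph}
  [hX : Finite X.V] {c : ℤ}

include hb

/-- The types alternate along the chain, and any two consecutive steps lose `3 b` against
`b ∑ p_i`. -/
theorem IsKeptType.chainF (h : IsKeptType b X c) :
    (∀ k : ℕ, t = 2 * k → IsKeptType b (chainF t p hp X) (c + b * ∑ i, (p i : ℤ) - b * (3 * k))) ∧
    ∀ k : ℕ, t = 2 * k + 1 →
      IsCutType b (_root_.chainF t p hp X) (c + b * ∑ i, (p i : ℤ) - b * (3 * k + 2) - 1) := by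
  induction t with
  | zero =>
    refine ⟨fun k hk ↦ ?_, fun k hk ↦ by omega⟩
    obtain rfl : k = 0 := by omega
    simpa [_root_.chainF] using h
  | succ t ih =>
    have := finite_chainF t (fun i ↦ p i.succ) (fun i ↦ hp i.succ) X
    obtain ⟨h1, h2⟩ := ih (p := fun i ↦ p i.succ) fun i ↦ hp i.succ
    rw [_root_.chainF, Fin.sum_univ_succ]
    refine ⟨fun k hk ↦ ?_, fun k hk ↦ ?_⟩
    · obtain ⟨j, rfl⟩ : ∃ j, k = j + 1 := ⟨k - 1, by omega⟩
      convert! (h2 j (by omega)).prependF (hp 0) hb using 1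
      push_cast
      ring
    · convert! (h1 k (by omega)).prependF (hp 0) hb using 1
      ring

theorem IsCutType.chainF (h : IsCutType b X c) :
    (∀ k : ℕ, t = 2 * k → IsCutType b (chainF t p hp X) (c + b * ∑ i, (p i : ℤ) - b * (3 * k))) ∧
    ∀ k : ℕ, t = 2 * k + 1 →
      IsKeptType b (_root_.chainF t p hp X) (c + b * ∑ i, (p i : ℤ) - b * (3 * k + 1) + 1) := by
  induction t with
  | zero =>
    refine ⟨fun k hk ↦ ?_, fun k hk ↦ by omega⟩
    obtain rfl : k = 0 := by omega
    simpa [_root_.chainF] using h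
  | succ t ih =>
    have := finite_chainF t (fun i ↦ p i.succ) (fun i ↦ hp i.succ) X
    obtain ⟨h1, h2⟩ := ih (p := fun i ↦ p i.succ) fun i ↦ hp i.succ
    rw [_root_.chainF, Fin.sum_univ_succ]
    refine ⟨fun k hk ↦ ?_, fun k hk ↦ ?_⟩
    · obtain ⟨j, rfl⟩ : ∃ j, k = j + 1 := ⟨k - 1, by omega⟩
      convert! (h2 j (by omega)).prependF (hp 0) hb using 1
      push_cast
      ring
    · convert! (h1 k (by omega)).prependF (hp 0) hb using 1
      ring

theorem IsKeptType.isMaxWeight_chainF (ht : 0 < t) (h : IsKeptType b X c) :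
    IsMaxWeight b (_root_.chainF t p hp X).graph
      (c + b * ∑ i, (p i : ℤ) - b * (t + (t / 2 : ℕ))) := by
  obtain ⟨t, rfl⟩ : ∃ s, t = s + 1 := ⟨t - 1, by omega⟩
  have := finite_chainF t (fun i ↦ p i.succ) (fun i ↦ hp i.succ) X
  obtain ⟨h1, h2⟩ := h.chainF hb (p := fun i ↦ p i.succ) fun i ↦ hp i.succ
  rw [_root_.chainF, Fin.sum_univ_succ]
  rcases Nat.even_or_odd' t with ⟨k, rfl | rfl⟩
  · convert! (h1 k rfl).isMaxWeight_prependF (hp 0) hb using 1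
    rw [show (2 * k + 1) / 2 = k by omega]
    push_cast
    ring
  · convert! (h2 k rfl).isMaxWeight_prependF (hp 0) hb using 1
    rw [show (2 * k + 1 + 1) / 2 = k + 1 by omega]
    push_cast
    ring

theorem IsCutType.isMaxWeight_chainF (ht : 0 < t) (h : IsCutType b X c) :
    IsMaxWeight b (_root_.chainF t p hp X).graph
      (c + 1 + b * ∑ i, (p i : ℤ) - b * (t + ((t - 1) / 2 : ℕ))) := by
  obtain ⟨t, rfl⟩ : ∃ s, t = s + 1 := ⟨t - 1, by omega⟩
  have := finite_chainF t (fun i ↦ p i.succ) (fun i ↦ hp i.succ) X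
  obtain ⟨h1, h2⟩ := h.chainF hb (p := fun i ↦ p i.succ) fun i ↦ hp i.succ
  rw [_root_.chainF, Fin.sum_univ_succ]
  rcases Nat.even_or_odd' t with ⟨k, rfl | rfl⟩
  · convert! (h1 k rfl).isMaxWeight_prependF (hp 0) hb using 1
    rw [show (2 * k + 1 - 1) / 2 = k by omega]
    push_cast
    ring
  · convert! (h2 k rfl).isMaxWeight_prependF (hp 0) hb using 1
    rw [show (2 * k + 1 + 1 - 1) / 2 = k by omega]
    push_cast
    ring

end LeafGraph

/-! ### The last graph of the chain -/

/-- The only leaves of `F_q` are `2q` and `1`. -/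
theorem graphF_leaf_cases {q : ℕ} (hq : 0 < q) {f v : Fin q ⊕ Fin q}
    (hf : (graphF q).neighborSet f = {v}) :
    (f = .inl (idxLst hq) ∧ v = .inr (idxLst hq)) ∨
      (f = .inr (idxFst hq) ∧ v = .inl (idxFst hq)) := by
  have hadj : ∀ x, (graphF q).Adj f x → x = v := fun x hx ↦ by
    rwa [← SimpleGraph.mem_neighborSet, hf, Set.mem_singleton_iff] at hx
  rcases f with i | j
  · have h1 := hadj (.inr i) (graphF_adj_inl_inr.2 le_rfl)
    have h2 := hadj (.inr (idxLst hq)) (graphF_adj_inl_inr.2 (by simp only [Fin.le_def]; omega))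
    have h3 : i = idxLst hq := Sum.inr_injective (h1.trans h2.symm)
    exact .inl ⟨by rw [h3], h2.symm⟩
  · have h1 := hadj (.inl j) (graphF_adj_inr_inl.2 le_rfl)
    have h2 := hadj (.inl (idxFst hq)) (graphF_adj_inr_inl.2 (by simp [Fin.le_def]))
    have h3 : j = idxFst hq := Sum.inl_injective (h1.trans h2.symm)
    exact .inr ⟨by rw [h3], h2.symm⟩

theorem isKeptType_graphF {b : ℤ} (hb : 0 ≤ b) {q : ℕ} (hq : 2 ≤ q) {f v : Fin q ⊕ Fin q}
    (hf : (graphF q).neighborSet f = {v}) :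
    LeafGraph.IsKeptType b ⟨Fin q ⊕ Fin q, graphF q, f, v, hf⟩ (b * q + 1) := by
  obtain ⟨φ, hφ, hφf, hφv, hφw⟩ : ∃ φ : Fin q ⊕ Fin q → Option ℕ, IsLabelling (graphF q) φ ∧
      φ f = none ∧ φ v ≠ none ∧ weight b φ + 1 = b * q + 1 := by
    obtain ⟨φ, hφ, h1, h2, hw⟩ := exists_graphF_lst_kept b (p := q) (by omega)
    rcases graphF_leaf_cases (by omega) hf with ⟨rfl, rfl⟩ | ⟨rfl, rfl⟩
    · exact ⟨φ, hφ, h1, h2, hw⟩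
    · refine ⟨_, hφ.comp_hom (graphFMirror q).toHom, ?_, ?_,
        (congrArg (· + 1) (weight_comp_equiv b (graphFMirror q).toEquiv φ)).trans hw⟩
      · exact (congrArg (fun i ↦ φ (.inl i)) (rev_idxFst _)).trans h1
      · exact fun h ↦ h2 ((congrArg (fun i ↦ φ (.inr i)) (rev_idxFst _)).symm.trans h)
  obtain ⟨ψ, hψ, hψf, hψv, hψw⟩ : ∃ φ : Fin q ⊕ Fin q → Option ℕ, IsLabelling (graphF q) φ ∧
      φ f = none ∧ φ v = none ∧ weight b φ + 1 = b * (q - 1) := by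
    obtain ⟨φ, hφ, h1, h2, hw⟩ := exists_graphF_lst_cut b (p := q) hq
    rcases graphF_leaf_cases (by omega) hf with ⟨rfl, rfl⟩ | ⟨rfl, rfl⟩
    · exact ⟨φ, hφ, h1, h2, hw⟩
    · refine ⟨_, hφ.comp_hom (graphFMirror q).toHom, ?_, ?_,
        (congrArg (· + 1) (weight_comp_equiv b (graphFMirror q).toEquiv φ)).trans hw⟩
      · exact (congrArg (fun i ↦ φ (.inl i)) (rev_idxFst _)).trans h1
      · exact (congrArg (fun i ↦ φ (.inr i)) (rev_idxFst _)).trans h2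
  refine ⟨⟨⟨φ, hφ, hφf, hφv, hφw⟩, ?_⟩, ⟨ψ, hψ, hψf, hψv, hψw.trans (by ring)⟩, ?_⟩
  · rintro _ ⟨χ, hχ, h1, h2, rfl⟩
    obtain ⟨χ', hχ', hw, -⟩ := hχ.exists_weight_add_one hf h1 h2 b
    exact hw ▸ graphF_weight_le (by omega) hb hχ'
  · rintro _ ⟨χ, hχ, h1, h2, rfl⟩
    obtain ⟨χ', hχ', hw, -⟩ := hχ.exists_weight_add hf h1 h2 b
    have := hw ▸ graphF_weight_le (by omega) hb hχ'
    have h3 : weight b χ ≤ b * q + 1 - (b + 2) := by linarith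
    exact (Int.add_le_add_right h3 1).trans (by linarith)

theorem exists_isMaxWeight {V : Type*} [Finite V] (G : SimpleGraph V) {b : ℤ} (hb : 0 ≤ b) :
    ∃ w, IsMaxWeight b G w := by
  have hbdd : ∀ x, (∃ φ : V → Option ℕ, IsLabelling G φ ∧ weight b φ = x) →
      x ≤ (b + 1) * Nat.card V := by
    rintro _ ⟨φ, -, rfl⟩
    have h1 : (labels φ).ncard ≤ Nat.card V := by
      rw [← Set.ncard_image_of_injective (labels φ) (Option.some_injective ℕ)]
      refine (Set.ncard_le_ncard (t := Set.range φ) ?_).trans ?_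
      · rintro _ ⟨l, ⟨v, hv⟩, rfl⟩
        exact ⟨v, hv⟩
      · rw [← Set.image_univ, ← Set.ncard_univ]
        exact Set.ncard_image_le
    have h2 : (b + 1) * ((labels φ).ncard : ℤ) ≤ (b + 1) * Nat.card V :=
      mul_le_mul_of_nonneg_left (mod_cast h1) (by linarith)
    rw [weight]
    have : (0 : ℤ) ≤ (cut φ).ncard := by positivity
    linarith
  obtain ⟨w, hw, hmax⟩ := Int.exists_greatest_of_bdd ⟨_, hbdd⟩
    ⟨_, fun _ ↦ none, fun u v _ k l hk ↦ by simp at hk, rfl⟩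
  exact ⟨w, hw, fun x hx ↦ hmax x hx⟩

namespace LeafGraph

/-- Suppose that the closed neighbourhood of a vertex `u` is contained in that of the neighbour
`v` of the leaf. A labelling that keeps `v` is turned into one that removes `v`: if `u` is present,
then it can take the place of `v` in its class; if `u` is removed, it can be put back instead of
`v`. -/
theorem exists_cut_of_kept {X : LeafGraph} [Finite X.V] (b : ℤ) {u : X.V} (hu : u ≠ X.leaf)
    (huv : X.graph.Adj u X.nbr) (hdom : ∀ x ≠ X.nbr, X.graph.Adj u x → X.graph.Adj X.nbr x)
    {φ : X.V → Option ℕ} (h : IsLabelling X.graph φ) (hl : φ X.leaf = none)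
    (hn : φ X.nbr ≠ none) :
    ∃ ψ : X.V → Option ℕ, IsLabelling X.graph ψ ∧ ψ X.leaf = none ∧ ψ X.nbr = none ∧
      weight b φ ≤ weight b ψ + 1 := by
  classical
  obtain ⟨l, hv⟩ := Option.ne_none_iff_exists'.1 hn
  let χ := Function.update φ X.nbr none
  have hχ : IsLabelling X.graph χ := h.update_none X.nbr
  have hχn : χ X.nbr = none := Function.update_self ..
  have hχo : ∀ x ≠ X.nbr, χ x = φ x := fun x hx ↦ Function.update_of_ne hx _ _
  have hχl : χ X.leaf = none := (hχo _ X.nbr_ne_leaf.symm).trans hl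
  have hφχ : φ = Function.update χ X.nbr (some l) := by
    simp only [χ, Function.update_idem, ← hv, Function.update_eq_self]
  have hne : u ≠ X.nbr := huv.ne
  by_cases hφu : φ u = none
  · refine ⟨Function.update χ u (some l), hχ.update_some ?_, ?_, ?_, ?_⟩
    · intro x hx k hk
      have hxn : x ≠ X.nbr := by
        rintro rfl
        simp [hχn] at hk
      exact (h (hdom x hxn hx) hv ((hχo x hxn).symm.trans hk)).symm
    · rwa [Function.update_of_ne hu.symm]
    · rwa [Function.update_of_ne hne.symm]
    · have hχu : χ u = none := (hχo u hne).trans hφu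
      have : weight b (Function.update χ u (some l)) =
          weight b (Function.update χ X.nbr (some l)) := by
        by_cases hmem : l ∈ labels χ
        · rw [weight_update_some_of_mem b hχu hmem, weight_update_some_of_mem b hχn hmem]
        · rw [weight_update_some_of_notMem b hχu hmem, weight_update_some_of_notMem b hχn hmem]
      rw [this, ← hφχ]
      linarith
  · refine ⟨χ, hχ, hχl, hχn, ?_⟩
    obtain ⟨k, hk⟩ := Option.ne_none_iff_exists'.1 hφu
    obtain rfl := h huv hk hv
    rw [hφχ, weight_update_some_of_mem b hχn ⟨u, (hχo u hne).trans hk⟩]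

/-- A marked graph in which the neighbour of the leaf dominates another vertex has cut type. The
maximal weight of the whole graph is then attained with the leaf as a class of its own. -/
theorem isCutType_of_dominated {X : LeafGraph} [Finite X.V] {b : ℤ} (hb : 0 ≤ b) {w : ℤ}
    (hw : IsMaxWeight b X.graph w) {u : X.V} (hu : u ≠ X.leaf) (huv : X.graph.Adj u X.nbr)
    (hdom : ∀ x ≠ X.nbr, X.graph.Adj u x → X.graph.Adj X.nbr x) :
    IsCutType b X (w - (b + 1)) := by
  classical
  have hupper : ∀ φ : X.V → Option ℕ, IsLabelling X.graph φ → φ X.leaf = none →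
      φ X.nbr = none → weight b φ + (b + 2) ≤ w := by
    intro φ hφ hl hn
    obtain ⟨ψ, hψ, hψw, -⟩ := hφ.exists_weight_add X.isLeaf hl hn b
    exact hψw ▸ hw.2 ⟨ψ, hψ, rfl⟩
  have hkept : ∀ φ : X.V → Option ℕ, IsLabelling X.graph φ → φ X.leaf = none →
      φ X.nbr ≠ none → weight b φ + (b + 1) ≤ w := by
    intro φ hφ hl hn
    obtain ⟨ψ, hψ, hψl, hψn, hψw⟩ := exists_cut_of_kept b hu huv hdom hφ hl hn
    have := hupper ψ hψ hψl hψn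
    linarith
  obtain ⟨φ, hφ, hφl, hφn, hφw⟩ : ∃ φ : X.V → Option ℕ, IsLabelling X.graph φ ∧
      φ X.leaf = none ∧ φ X.nbr = none ∧ w ≤ weight b φ + (b + 2) := by
    obtain ⟨φ, hφ, rfl⟩ := hw.1
    by_cases hl : φ X.leaf = none
    · by_cases hn : φ X.nbr = none
      · have := hupper φ hφ hl hn
        linarith
      · have := hkept φ hφ hl hn
        linarith
    obtain ⟨l, hl⟩ := Option.ne_none_iff_exists'.1 hl
    let χ := Function.update φ X.leaf none
    have hχ : IsLabelling X.graph χ := hφ.update_none X.leaf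
    have hχl : χ X.leaf = none := Function.update_self ..
    have hχn : χ X.nbr = φ X.nbr := Function.update_of_ne X.nbr_ne_leaf _ _
    have hφχ : φ = Function.update χ X.leaf (some l) := by
      simp only [χ, Function.update_idem, ← hl, Function.update_eq_self]
    by_cases hn : φ X.nbr = none
    · refine ⟨χ, hχ, hχl, hχn.trans hn, ?_⟩
      rw [hφχ]
      by_cases hmem : l ∈ labels χ
      · rw [weight_update_some_of_mem b hχl hmem]
        linarith
      · rw [weight_update_some_of_notMem b hχl hmem]
    · obtain ⟨k, hk⟩ := Option.ne_none_iff_exists'.1 hn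
      obtain rfl := hφ (X.adj_leaf_iff.2 rfl) hl hk
      obtain ⟨ψ, hψ, hψl, hψn, hψw⟩ :=
        exists_cut_of_kept b hu huv hdom hχ hχl (by rwa [hχn])
      refine ⟨ψ, hψ, hψl, hψn, ?_⟩
      rw [hφχ, weight_update_some_of_mem b hχl ⟨_, hχn.trans hk⟩]
      linarith
  refine ⟨⟨⟨φ, hφ, hφl, hφn, ?_⟩, ?_⟩, ?_⟩
  · have := hupper φ hφ hφl hφn
    linarith
  · rintro _ ⟨ψ, hψ, hψl, hψn, rfl⟩
    have := hupper ψ hψ hψl hψn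
    linarith
  · rintro _ ⟨ψ, hψ, hψl, hψn, rfl⟩
    have := hkept ψ hψ hψl hψn
    linarith

end LeafGraph

namespace FanData

variable {n k : ℕ} (D : FanData n k)

theorem mem_part_iff {i : Fin k} {x : Fin n} : x ∈ D.part i ↔ ∃ j, D.w i j = x := by
  simp [part]

theorem mem_support_iff {x : Fin n} : x ∈ D.support ↔ ∃ i j, D.w i j = x := by
  simp [support, part]

theorem w_eq_iff {i i' : Fin k} {j : Fin (D.r i)} {j' : Fin (D.r i')} :
    D.w i j = D.w i' j' ↔ (⟨i, j⟩ : Σ i, Fin (D.r i)) = ⟨i', j'⟩ :=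
  D.w_injective.eq_iff (a := ⟨i, j⟩) (b := ⟨i', j'⟩)

/-- The neighbour of a leaf of a fan graph dominates another vertex: a vertex of `K_n` outside
`W`, or the last vertex of the part `W_i` that contains the neighbour. -/
theorem exists_dominated (hk : 1 ≤ k) {f v : D.Vertex} (hf : D.graph.neighborSet f = {v})
    (h : D.support.card < n ∨
      (D.support.card = n ∧ ∃ i, 2 ≤ (D.part i).card ∧ ∃ x ∈ D.part i, v = .inl x)) :
    ∃ u, u ≠ f ∧ D.graph.Adj u v ∧ ∀ x ≠ v, D.graph.Adj u x → D.graph.Adj v x := by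
  have hadj : ∀ x, D.graph.Adj f x → x = v := fun x hx ↦ by
    rwa [← SimpleGraph.mem_neighborSet, hf, Set.mem_singleton_iff] at hx
  have hfv : D.graph.Adj f v := by
    rw [← SimpleGraph.mem_neighborSet, hf, Set.mem_singleton_iff]
  rcases f with x | ⟨i, j, a⟩
  · rcases v with y | ⟨i, j, a⟩
    · -- `K_n` has only the vertices `x` and `y`, and `x` does not lie in `W`.
      have hx : ∀ i j, D.w i j ≠ x := by
        rintro i j rfl
        simpa using hadj (.inr ⟨i, j, ⟨0, D.h_pos i j⟩⟩) ⟨j, le_rfl, rfl⟩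
      let i₀ : Fin k := ⟨0, hk⟩
      let j₀ : Fin (D.r i₀) := ⟨0, D.r_pos i₀⟩
      have hy : D.w i₀ j₀ = y := Sum.inl_injective (hadj (.inl (D.w i₀ j₀)) (hx i₀ j₀).symm)
      refine ⟨.inr ⟨i₀, j₀, ⟨0, D.h_pos i₀ j₀⟩⟩, by simp, ⟨j₀, le_rfl, hy.symm⟩, ?_⟩
      rintro (z | ⟨i, j, a⟩) hz hadjz
      · obtain ⟨l, hl, rfl⟩ := hadjz
        have : l = j₀ := by
          ext
          simpa [j₀, Fin.le_def] using hl
        exact (hz (by rw [this, hy])).elim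
      · have h1 := hadjz.1
        obtain ⟨rfl, h2⟩ := Sigma.mk.inj h1
        obtain rfl := eq_of_heq h2
        exact ⟨j₀, le_rfl, hy.symm⟩
    · -- `K_n` has only the vertex `x`, which lies in `W`, so `|W| = n = 1`; this is excluded.
      exfalso
      obtain ⟨l, -, rfl⟩ := hfv
      have hx : ∀ z, z = D.w i l := fun z ↦ by
        by_contra hz
        simpa using hadj (.inl z) (Ne.symm hz)
      have hn : n ≤ 1 := by
        have : Subsingleton (Fin n) := ⟨fun y z ↦ (hx y).trans (hx z).symm⟩
        simpa using Fintype.card_le_one_iff_subsingleton.2 this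
      rcases h with h | ⟨-, i', h2, -⟩
      · have : 0 < D.support.card :=
          Finset.card_pos.2 ⟨_, D.mem_support_iff.2 ⟨i, l, rfl⟩⟩
        omega
      · have := (D.part i').card_le_univ
        rw [Fintype.card_fin] at this
        omega
  · let j₀ : Fin (D.r i) := ⟨0, D.r_pos i⟩
    obtain rfl := hadj (.inl (D.w i j₀)) ⟨j₀, Fin.le_def.2 (Nat.zero_le _), rfl⟩
    rcases h with h | ⟨-, i', h2, x, hx, hxv⟩
    · obtain ⟨u, hu⟩ : ∃ u, u ∉ D.support := by
        by_contra! hu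
        rw [Finset.eq_univ_of_forall hu, Finset.card_univ, Fintype.card_fin] at h
        exact h.false
      have hu' : ∀ i j, u ≠ D.w i j := fun i j huw ↦ hu (D.mem_support_iff.2 ⟨i, j, huw.symm⟩)
      refine ⟨.inl u, by simp, hu' i j₀, ?_⟩
      rintro (z | ⟨i', j', a'⟩) hz hadjz
      · exact fun hzw ↦ hz (by rw [hzw])
      · obtain ⟨l, -, hl⟩ := hadjz
        exact (hu' _ _ hl).elim
    · obtain ⟨j', hj'⟩ := D.mem_part_iff.1 hx
      obtain rfl : i = i' := by
        rw [← Sum.inl_injective hxv, D.w_eq_iff] at hj'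
        exact (Sigma.mk.inj hj').1.symm
      have hr : 2 ≤ D.r i := by
        refine h2.trans (Finset.card_image_le.trans ?_)
        simp
      let j₁ : Fin (D.r i) := ⟨D.r i - 1, by omega⟩
      have hne : D.w i j₁ ≠ D.w i j₀ := by
        intro h
        have h1 := eq_of_heq (Sigma.mk.inj (D.w_eq_iff.1 h)).2
        simp only [j₁, j₀, Fin.mk.injEq] at h1
        omega
      refine ⟨.inl (D.w i j₁), by simp, hne, ?_⟩
      rintro (z | ⟨i'', j'', a''⟩) hz hadjz
      · exact fun hzw ↦ hz (by rw [hzw])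
      · obtain ⟨l, -, hl⟩ := hadjz
        obtain ⟨rfl, -⟩ := Sigma.mk.inj (D.w_eq_iff.1 hl)
        exact ⟨j₀, Fin.le_def.2 (Nat.zero_le _), rfl⟩

end FanData

theorem floor_natCast_div_two (t : ℕ) : ⌊(t : ℚ) / 2⌋ = (t / 2 : ℕ) := by
  have h1 : 2 * (t / 2) ≤ t := by omega
  have h2 : t < 2 * (t / 2) + 2 := by omega
  generalize t / 2 = s at h1 h2
  qify at h1 h2
  rw [Int.floor_eq_iff, Int.cast_natCast]
  constructor <;> linarith

theorem ceil_natCast_div_two {t : ℕ} (ht : 0 < t) : ⌈(t : ℚ) / 2⌉ = ((t - 1) / 2 : ℕ) + 1 := by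
  have h1 : 2 * ((t - 1) / 2) + 1 ≤ t := by omega
  have h2 : t ≤ 2 * ((t - 1) / 2) + 2 := by omega
  generalize (t - 1) / 2 = s at h1 h2
  qify at h1 h2
  rw [Int.ceil_eq_iff, Int.cast_add, Int.cast_natCast, Int.cast_one]
  constructor <;> linarith

theorem dimQuot_graphF {K : Type*} [Field K] {m : ℕ} (hm : 2 ≤ m) {p : ℕ} (hp : 0 < p) :
    ∃ d : ℕ, dimQuot K m (graphF p) = d ∧ (d : ℤ) = m * p + 1 := by
  obtain ⟨d, hd, hd'⟩ := (isMaxWeight_graphF (b := m - 2) (by omega) hp).dimQuot_eq (K := K)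
    (by omega)
  refine ⟨d, hd, ?_⟩
  rw [hd', Nat.card_sum, Nat.card_fin]
  push_cast
  ring

theorem dimQuot_chainF {K : Type*} [Field K] {m : ℕ} (hm : 2 ≤ m) {t : ℕ} {p : Fin t → ℕ}
    (hp : ∀ i, 3 ≤ p i) {V : Type*} {G : SimpleGraph V} {X : LeafGraph} [Finite X.V]
    (e : G ≃g (chainF t p hp X).graph) {w : ℤ}
    (hw : IsMaxWeight (m - 2) (chainF t p hp X).graph w) :
    ∃ d : ℕ, dimQuot K m G = d ∧
      (d : ℤ) = w + 2 * ∑ i, (p i : ℤ) + Nat.card X.V - 3 * t := by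
  have := LeafGraph.finite_chainF t p hp X
  have : Finite V := Finite.of_equiv _ e.toEquiv.symm
  obtain ⟨d, hd, hd'⟩ := (hw.of_iso e).dimQuot_eq (K := K) (by omega)
  refine ⟨d, hd, ?_⟩
  rw [hd', Nat.card_congr e.toEquiv, LeafGraph.card_chainF]
  ring

theorem mainTheorem8 {K : Type*} [Field K] (m : ℕ) (hm : 2 ≤ m)
    (t : ℕ) (ht : 2 ≤ t) (p : Fin t → ℕ) (hp : ∀ i, 3 ≤ p i)
    {V : Type*} (G : SimpleGraph V) :
    -- the last graph is `F_q`, glued at any of its leaves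
    (∀ (q : ℕ), 2 ≤ q →
      ∀ (f v : Fin q ⊕ Fin q) (hf : (graphF q).neighborSet f = {v}),
      Nonempty (G ≃g (chainF t p hp ⟨Fin q ⊕ Fin q, graphF q, f, v, hf⟩).graph) →
      ∃ (d : ℕ) (e : Fin t → ℕ) (e' : ℕ),
        dimQuot K m G = d ∧ (∀ i, dimQuot K m (graphF (p i)) = e i) ∧
        dimQuot K m (graphF q) = e' ∧
        (d : ℤ) = (∑ i, (e i : ℤ)) + e'
          - (2 * m * ⌊(t : ℚ) / 2⌋ + (m + 2) * ⌈(t : ℚ) / 2⌉)) ∧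
    -- the last graph is a `k`-fan graph, glued at any of its leaves `f`, with neighbour `v`
    (∀ (n k : ℕ) (D : FanData n k), 1 ≤ k →
      ∀ (f v : D.Vertex) (hf : D.graph.neighborSet f = {v}),
      (D.support.card < n ∨
        (D.support.card = n ∧ ∃ i, 2 ≤ (D.part i).card ∧ ∃ x ∈ D.part i, v = .inl x)) →
      Nonempty (G ≃g (chainF t p hp ⟨D.Vertex, D.graph, f, v, hf⟩).graph) →
      ∃ (d : ℕ) (e : Fin t → ℕ) (e' : ℕ),
        dimQuot K m G = d ∧ (∀ i, dimQuot K m (graphF (p i)) = e i) ∧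
        dimQuot K m D.graph = e' ∧
        (d : ℤ) = (∑ i, (e i : ℤ)) + e'
          - (2 * m * ⌈(t : ℚ) / 2⌉ + (m + 2) * ⌊(t : ℚ) / 2⌋)) := by
  have hm' : (0 : ℤ) ≤ m - 2 := by omega
  choose e he he' using fun i ↦ dimQuot_graphF (K := K) hm (p := p i) (by have := hp i; omega)
  have hsum : ∑ i, (e i : ℤ) = m * ∑ i, (p i : ℤ) + t := by
    simp only [he', Finset.sum_add_distrib, Finset.mul_sum]
    simp
  have hfloor := floor_natCast_div_two t
  have hceil := ceil_natCast_div_two (t := t) (by omega)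
  have hfc : (t : ℤ) = (t / 2 : ℕ) + ((t - 1) / 2 : ℕ) + 1 := by omega
  refine ⟨?_, ?_⟩
  · rintro q hq f v hf ⟨iso⟩
    obtain ⟨e', hq1, hq2⟩ := dimQuot_graphF (K := K) hm (p := q) (by omega)
    have : Finite (LeafGraph.mk (Fin q ⊕ Fin q) (graphF q) f v hf).V :=
      inferInstanceAs (Finite (Fin q ⊕ Fin q))
    obtain ⟨d, hd, hd'⟩ := dimQuot_chainF (K := K) hm hp iso
      ((isKeptType_graphF hm' hq hf).isMaxWeight_chainF hm' hp (by omega))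
    refine ⟨d, e, e', hd, he, hq1, ?_⟩
    have hcard : Nat.card (Fin q ⊕ Fin q) = 2 * q := by
      rw [Nat.card_sum, Nat.card_fin, two_mul]
    rw [hd', hsum, hq2, hfloor, hceil]
    change _ + (Nat.card (Fin q ⊕ Fin q) : ℤ) - _ = _
    rw [hcard, Nat.cast_mul, Nat.cast_ofNat]
    linear_combination (-4 - (m - 2 : ℤ)) * hfc
  · rintro n k D hk f v hf h ⟨iso⟩
    have : Finite (LeafGraph.mk D.Vertex D.graph f v hf).V := inferInstanceAs (Finite D.Vertex)
    obtain ⟨w, hw⟩ := exists_isMaxWeight D.graph hm'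
    obtain ⟨e', hq1, hq2⟩ := hw.dimQuot_eq (K := K) (by omega)
    obtain ⟨u, hu, huv, hdom⟩ := D.exists_dominated hk hf h
    have hX := LeafGraph.isCutType_of_dominated (X := ⟨D.Vertex, D.graph, f, v, hf⟩) hm' hw hu
      huv hdom
    obtain ⟨d, hd, hd'⟩ := dimQuot_chainF (K := K) hm hp iso
      (hX.isMaxWeight_chainF hm' hp (by omega))
    refine ⟨d, e, e', hd, he, hq1, ?_⟩
    rw [hd', hsum, hq2, hfloor, hceil]
    change _ + (Nat.card D.Vertex : ℤ) - _ = _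
    linear_combination (-4 - (m - 2 : ℤ)) * hfc
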